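/- For $n\ge 2$ let $\mathfrak{psl}_{n|n}$ be the complex Lie superalgebra of $2n\times 2n$ supermatrices $X\in\mathrm{End}(\mathbb{C}^{n|n})$ with $\mathrm{str}\,X=0$, modulo the ideal spanned by the identity matrix, with the supercommutator as bracket and the invariant form $(X,Y)=\mathrm{str}(XY)$. Let $E^{i,j}$ ($1\le i\ne j\le 2n$) be (the class of) the elementary supermatrix. Let $\widehat{\mathfrak g}$ be the affine Lie superalgebra spanned by the modes $x_{(m)}=x\,t^m$ ($x\in\mathfrak{psl}_{n|n}$, $m\in\mathbb{Z}$), a central element $K$ and the translation operator $T$, with $$[x_{(m)},y_{(l)}]=[x,y]_{(m+l)}+m\,\delta_{m+l,0}\,\mathrm{str}(xy)\,K,\qquad [T,x_{(m)}]=-m\,x_{(m-1)}.$$ Let $V^1(\mathfrak{psl}_{n|n})$ be the universal affine vertex superalgebra at level $1$: the $\widehat{\mathfrak g}$-module induced from the one-dimensional module $\mathbb{C}|0\rangle$ on which $x_{(m)}$ ($m\ge 0$) and $T$ act by $0$ and $K$ acts by $1$. A vector $v\in V^1(\mathfrak{psl}_{n|n})$ is called singular if $E^{i,j}_{(0)}v=0$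 for all $1\le i<j\le 2n$ and $x_{(m)}v=0$ for all $x\in\mathfrak{psl}_{n|n}$ and $m\ge 1$. Put $$\chi=E^{1,2n-1}_{(-1)}E^{1,2n}_{(-1)}|0\rangle,$$ let $U=\langle\chi\rangle$ be the $\widehat{\mathfrak g}$-submodule generated by $\chi$, and put $$\chi_+=\bigl(E^{1,n}_{(-1)}\bigr)^2|0\rangle,\qquad \chi_-=\bigl(E^{n+1,2n}_{(-1)}E^{n+2,2n-1}_{(-1)}-E^{n+1,2n-1}_{(-1)}E^{n+2,2n}_{(-1)}\bigr)|0\rangle.$$ (a) For every $n>1$, the vector $\chi_+$ is not singular in $V^1(\mathfrak{psl}_{n|n})$, but $\chi_+\in U$; explicitly, $$\chi_+=-E^{2n-1,n}_{(1)}\,T\,E^{2n,n}_{(1)}\,T\,\chi .$$ (b) For every $n>3$, the vector $\chi_-$ is not singular in $V^1(\mathfrak{psl}_{n|n})$, but $\chi_-\in U$; explicitly, $$\chi_-=-E^{n+2,1}_{(1)}\,T\,E^{n+1,1}_{(1)}\,T\,\chi .$$ -/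

import Mathlib

/-! ### Lie superalgebras and invariant forms -/

/-- The sign `(-1)^(a b)` for parities `a b`. -/
def superSign (a b : ZMod 2) : ℂ := if a = 1 ∧ b = 1 then -1 else 1

/-- A complex Lie superalgebra: a vector space with a decomposition into an even part `part 0` and
an odd part `part 1`, and an even, super-skew bracket satisfying the super Jacobi identity. -/
class LieSuperalgebra (L : Type) [AddCommGroup L] [Module ℂ L] where
  part : ZMod 2 → Submodule ℂ L
  isCompl : IsCompl (part 0) (part 1)
  bracket : L →ₗ[ℂ] L →ₗ[ℂ] L
  bracket_mem : ∀ {a b : ZMod 2} {x y : L}, x ∈ part a → y ∈ part b → bracket x y ∈ part (a + b)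
  bracket_skew : ∀ {a b : ZMod 2} {x y : L}, x ∈ part a → y ∈ part b →
    bracket x y = -(superSign a b • bracket y x)
  jacobi : ∀ {a b c : ZMod 2} {x y z : L}, x ∈ part a → y ∈ part b → z ∈ part c →
    bracket x (bracket y z) = bracket (bracket x y) z + superSign a b • bracket y (bracket x z)

/-- An even, supersymmetric, invariant bilinear form on a Lie superalgebra. -/
structure InvariantForm (L : Type) [AddCommGroup L] [Module ℂ L] [LieSuperalgebra L] where
  form : L →ₗ[ℂ] L →ₗ[ℂ] ℂ
  even : ∀ {a b : ZMod 2} {x y : L}, x ∈ LieSuperalgebra.part a → y ∈ LieSuperalgebra.part b →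
    a ≠ b → form x y = 0
  symm : ∀ {a b : ZMod 2} {x y : L}, x ∈ LieSuperalgebra.part a → y ∈ LieSuperalgebra.part b →
    form x y = superSign a b * form y x
  invariant : ∀ x y z : L,
    form (LieSuperalgebra.bracket x y) z = form x (LieSuperalgebra.bracket y z)

/-! ### The affine Lie superalgebra and its vacuum modules -/

section Affine

/-- Generators of the enveloping algebra of `L[t, t⁻¹] ⊕ ℂ K ⊕ ℂ T`; `mode x m` is `x t ^ m`. -/
inductive AffineGen (L : Type) : Type
  | mode (x : L) (m : ℤ) : AffineGen L
  | central : AffineGen L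
  | translation : AffineGen L

variable {L : Type} [AddCommGroup L] [Module ℂ L] [LieSuperalgebra L]

open AffineGen in
/-- The defining relations of the enveloping algebra of the affine Lie superalgebra:
`x ↦ x t ^ m` is linear, `K` is central, `T` acts as `-d/dt`, and
`[x t ^ m, y t ^ l] = [x, y] t ^ (m + l) + m δ_{m + l, 0} (x, y) K`, where the bracket on the left
is the supercommutator. -/
inductive AffineRel (B : InvariantForm L) :
    FreeAlgebra ℂ (AffineGen L) → FreeAlgebra ℂ (AffineGen L) → Prop
  | add (x y : L) (m : ℤ) : AffineRel B
      (FreeAlgebra.ι ℂ (mode (x + y) m))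
      (FreeAlgebra.ι ℂ (mode x m) + FreeAlgebra.ι ℂ (mode y m))
  | smul (c : ℂ) (x : L) (m : ℤ) : AffineRel B
      (FreeAlgebra.ι ℂ (mode (c • x) m))
      (c • FreeAlgebra.ι ℂ (mode x m))
  | bracket {a b : ZMod 2} {x y : L} (hx : x ∈ LieSuperalgebra.part a)
      (hy : y ∈ LieSuperalgebra.part b) (m l : ℤ) : AffineRel B
      (FreeAlgebra.ι ℂ (mode x m) * FreeAlgebra.ι ℂ (mode y l)
        - superSign a b • (FreeAlgebra.ι ℂ (mode y l) * FreeAlgebra.ι ℂ (mode x m)))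
      (FreeAlgebra.ι ℂ (mode (LieSuperalgebra.bracket x y) (m + l))
        + (if m + l = 0 then (m : ℂ) * B.form x y else 0) • FreeAlgebra.ι ℂ central)
  | central_mode (x : L) (m : ℤ) : AffineRel B
      (FreeAlgebra.ι ℂ central * FreeAlgebra.ι ℂ (mode x m))
      (FreeAlgebra.ι ℂ (mode x m) * FreeAlgebra.ι ℂ central)
  | central_translation : AffineRel B
      (FreeAlgebra.ι ℂ central * FreeAlgebra.ι ℂ translation)
      (FreeAlgebra.ι ℂ translation * FreeAlgebra.ι ℂ central)
  | translation_mode (x : L) (m : ℤ) : AffineRel B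
      (FreeAlgebra.ι ℂ translation * FreeAlgebra.ι ℂ (mode x m)
        - FreeAlgebra.ι ℂ (mode x m) * FreeAlgebra.ι ℂ translation)
      (-(m : ℂ) • FreeAlgebra.ι ℂ (mode x (m - 1)))

/-- The universal enveloping algebra of the affine Lie superalgebra
`L[t, t⁻¹] ⊕ ℂ K ⊕ ℂ T` attached to `L` and the invariant form `B`. -/
def AffineEnveloping (B : InvariantForm L) : Type := RingQuot (AffineRel B)

noncomputable instance (B : InvariantForm L) : Ring (AffineEnveloping B) :=
  inferInstanceAs (Ring (RingQuot (AffineRel B)))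

noncomputable instance (B : InvariantForm L) : Algebra ℂ (AffineEnveloping B) :=
  inferInstanceAs (Algebra ℂ (RingQuot (AffineRel B)))

namespace AffineEnveloping

/-- The image of a generator. -/
noncomputable def of (B : InvariantForm L) (g : AffineGen L) : AffineEnveloping B :=
  RingQuot.mkAlgHom ℂ (AffineRel B) (FreeAlgebra.ι ℂ g)

/-- The mode `x_(m) = x t ^ m`. -/
noncomputable def mode (B : InvariantForm L) (x : L) (m : ℤ) : AffineEnveloping B :=
  of B (AffineGen.mode x m)

/-- The central element `K`. -/
noncomputable def central (B : InvariantForm L) : AffineEnveloping B := of B AffineGen.central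

/-- The translation operator `T`. -/
noncomputable def translation (B : InvariantForm L) : AffineEnveloping B :=
  of B AffineGen.translation

end AffineEnveloping

open AffineEnveloping in
/-- The left ideal of elements killing the vacuum: it is generated by the modes `x_(m)` with
`0 ≤ m`, by `K - k`, and by `T`. -/
noncomputable def vacuumIdeal (B : InvariantForm L) (k : ℂ) :
    Submodule (AffineEnveloping B) (AffineEnveloping B) :=
  Submodule.span (AffineEnveloping B)
    ({u | ∃ (x : L) (m : ℤ), 0 ≤ m ∧ u = mode B x m}
      ∪ {central B - algebraMap ℂ (AffineEnveloping B) k, translation B})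

/-- The universal affine vertex superalgebra `V^k(L)` as a module over the affine Lie superalgebra:
the module induced from the one-dimensional `L[t] ⊕ ℂ K ⊕ ℂ T`-module on which `L[t]` and `T` act
by zero and `K` acts by `k`. -/
abbrev UniversalAffine (B : InvariantForm L) (k : ℂ) : Type :=
  AffineEnveloping B ⧸ vacuumIdeal B k

/-- The vacuum vector `|0⟩`. -/
noncomputable def vacuum (B : InvariantForm L) (k : ℂ) : UniversalAffine B k :=
  Submodule.Quotient.mk (1 : AffineEnveloping B)

open AffineEnveloping in
/-- The subspace `n₊ ⊕ t L[t]` of the affine Lie superalgebra, for a subspace `N = n₊` of `L`. -/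
noncomputable def affineNilpotent (B : InvariantForm L) (N : Submodule ℂ L) :
    Submodule ℂ (AffineEnveloping B) :=
  Submodule.span ℂ ({u | ∃ x ∈ N, u = mode B x 0}
    ∪ {u | ∃ (x : L) (m : ℤ), 0 < m ∧ u = mode B x m})

end Affine

/-! ### The Lie superalgebra `psl(n|n)` -/

section Psl

variable (n : ℕ)

/-- Supermatrices acting on `ℂ^(n|n)`. -/
abbrev SuperMat : Type := Matrix (Fin (2 * n)) (Fin (2 * n)) ℂ

variable {n}

/-- The first `n` basis vectors of `ℂ^(n|n)` are even, the last `n` are odd. -/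
def idxParity (i : Fin (2 * n)) : ZMod 2 := if i.val < n then 0 else 1

variable (n)

/-- The supermatrices that are homogeneous of parity `a`. -/
def matPart (a : ZMod 2) : Submodule ℂ (SuperMat n) where
  carrier := {X | ∀ i j, idxParity i + idxParity j ≠ a → X i j = 0}
  add_mem' := by
    intro X Y hX hY i j h
    simp [hX i j h, hY i j h]
  zero_mem' := by
    intro i j _
    rfl
  smul_mem' := by
    intro c X hX i j h
    simp [hX i j h]

/-- The projection to the homogeneous component of parity `a`. -/
def matProj (a : ZMod 2) : SuperMat n →ₗ[ℂ] SuperMat n where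
  toFun X := Matrix.of fun i j => if idxParity i + idxParity j = a then X i j else 0
  map_add' X Y := by
    ext i j
    by_cases h : idxParity i + idxParity j = a <;> simp [h]
  map_smul' c X := by
    ext i j
    by_cases h : idxParity i + idxParity j = a <;> simp [h]

/-- The supercommutator: the bilinear extension of `[X, Y] = X Y - (-1)^(|X| |Y|) Y X`. -/
def matBracket : SuperMat n →ₗ[ℂ] SuperMat n →ₗ[ℂ] SuperMat n :=
  LinearMap.mk₂ ℂ
    (fun X Y => ∑ a : ZMod 2, ∑ b : ZMod 2,
      (matProj n a X * matProj n b Y - superSign a b • (matProj n b Y * matProj n a X)))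
    (by
      intro X X' Y
      simp only [← Finset.sum_add_distrib, map_add, add_mul, mul_add, smul_add]
      refine Finset.sum_congr rfl fun a _ => Finset.sum_congr rfl fun b _ => ?_
      abel)
    (by
      intro c X Y
      simp only [Finset.smul_sum, map_smul, smul_mul_assoc, mul_smul_comm, smul_sub]
      refine Finset.sum_congr rfl fun a _ => Finset.sum_congr rfl fun b _ => ?_
      rw [smul_comm])
    (by
      intro X Y Y'
      simp only [← Finset.sum_add_distrib, map_add, add_mul, mul_add, smul_add]
      refine Finset.sum_congr rfl fun a _ => Finset.sum_congr rfl fun b _ => ?_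
      abel)
    (by
      intro c X Y
      simp only [Finset.smul_sum, map_smul, smul_mul_assoc, mul_smul_comm, smul_sub]
      refine Finset.sum_congr rfl fun a _ => Finset.sum_congr rfl fun b _ => ?_
      rw [smul_comm])

/-- The supertrace. -/
def superTrace : SuperMat n →ₗ[ℂ] ℂ where
  toFun X := ∑ i, (if idxParity i = 0 then 1 else -1 : ℂ) * X i i
  map_add' X Y := by simp [mul_add, Finset.sum_add_distrib]
  map_smul' c X := by
    simp only [Matrix.smul_apply, smul_eq_mul, Finset.mul_sum, RingHom.id_apply]
    exact Finset.sum_congr rfl fun i _ => by ring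

variable {n}

theorem matProj_of_mem {a : ZMod 2} {X : SuperMat n} (hX : X ∈ matPart n a) (c : ZMod 2) :
    matProj n c X = if c = a then X else 0 := by
  ext i j
  by_cases hc : c = a
  · subst hc
    by_cases h : idxParity i + idxParity j = c
    · simp [matProj, h]
    · simp [matProj, h, hX i j h]
  · by_cases h : idxParity i + idxParity j = c
    · have : idxParity i + idxParity j ≠ a := fun h' => hc (h.symm.trans h')
      simp [matProj, h, hc, hX i j this]
    · simp [matProj, h, hc]

theorem matProj_mem (a : ZMod 2) (X : SuperMat n) : matProj n a X ∈ matPart n a := by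
  intro i j h
  simp [matProj, h]

theorem matProj_add (X : SuperMat n) : matProj n 0 X + matProj n 1 X = X := by
  ext i j
  have : ∀ c : ZMod 2, c = 0 ∨ c = 1 := by decide
  rcases this (idxParity i + idxParity j) with h | h <;> simp [matProj, h]

theorem matBracket_of_mem {a b : ZMod 2} {X Y : SuperMat n} (hX : X ∈ matPart n a)
    (hY : Y ∈ matPart n b) : matBracket n X Y = X * Y - superSign a b • (Y * X) := by
  simp only [matBracket, LinearMap.mk₂_apply, matProj_of_mem hX, matProj_of_mem hY]
  rw [Finset.sum_eq_single a, Finset.sum_eq_single b] <;> simp +contextual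

theorem mul_mem_matPart {a b : ZMod 2} {X Y : SuperMat n} (hX : X ∈ matPart n a)
    (hY : Y ∈ matPart n b) : X * Y ∈ matPart n (a + b) := by
  intro i j h
  rw [Matrix.mul_apply]
  refine Finset.sum_eq_zero fun k _ => ?_
  by_cases h1 : idxParity i + idxParity k = a
  · by_cases h2 : idxParity k + idxParity j = b
    · refine absurd ?_ h
      rw [← h1, ← h2]
      have : ∀ p q r : ZMod 2, p + r = p + q + (q + r) := by decide
      exact this _ _ _
    · rw [hY k j h2, mul_zero]
  · rw [hX i k h1, zero_mul]

theorem one_mem_matPart : (1 : SuperMat n) ∈ matPart n 0 := by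
  intro i j h
  refine Matrix.one_apply_ne fun hij => h ?_
  subst hij
  have : ∀ p : ZMod 2, p + p = 0 := by decide
  exact this _

theorem matBracket_mem {a b : ZMod 2} {X Y : SuperMat n} (hX : X ∈ matPart n a)
    (hY : Y ∈ matPart n b) : matBracket n X Y ∈ matPart n (a + b) := by
  rw [matBracket_of_mem hX hY]
  refine Submodule.sub_mem _ (mul_mem_matPart hX hY) (Submodule.smul_mem _ _ ?_)
  rw [add_comm]
  exact mul_mem_matPart hY hX

theorem superSign_comm (a b : ZMod 2) : superSign a b = superSign b a := by
  simp only [superSign, and_comm]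

theorem superSign_mul_self (a b : ZMod 2) : superSign a b * superSign a b = 1 := by
  unfold superSign
  split_ifs <;> norm_num

theorem superSign_add (a b c : ZMod 2) :
    superSign a (b + c) = superSign a b * superSign a c := by
  have h : ∀ p : ZMod 2, p = 0 ∨ p = 1 := by decide
  have h2 : (1 + 1 : ZMod 2) = 0 := by decide
  rcases h a with rfl | rfl <;> rcases h b with rfl | rfl <;> rcases h c with rfl | rfl <;>
    simp [superSign, h2]

theorem matBracket_skew {a b : ZMod 2} {X Y : SuperMat n} (hX : X ∈ matPart n a)
    (hY : Y ∈ matPart n b) :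
    matBracket n X Y = -(superSign a b • matBracket n Y X) := by
  rw [matBracket_of_mem hX hY, matBracket_of_mem hY hX, superSign_comm b a, smul_sub, smul_smul,
    superSign_mul_self, one_smul]
  abel

theorem matBracket_jacobi {a b c : ZMod 2} {X Y Z : SuperMat n} (hX : X ∈ matPart n a)
    (hY : Y ∈ matPart n b) (hZ : Z ∈ matPart n c) :
    matBracket n X (matBracket n Y Z) =
      matBracket n (matBracket n X Y) Z + superSign a b • matBracket n Y (matBracket n X Z) := by
  rw [matBracket_of_mem hX (matBracket_mem hY hZ), matBracket_of_mem (matBracket_mem hX hY) hZ,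
    matBracket_of_mem hY (matBracket_mem hX hZ), matBracket_of_mem hX hY,
    matBracket_of_mem hY hZ, matBracket_of_mem hX hZ, superSign_comm (a + b) c,
    superSign_add, superSign_add, superSign_add, superSign_comm b a, superSign_comm c a,
    superSign_comm c b]
  have h : ∀ p q : ZMod 2, superSign p q = 1 ∨ superSign p q = -1 := fun p q => by
    unfold superSign
    split_ifs <;> simp
  rcases h a b with h1 | h1 <;> rcases h a c with h2 | h2 <;> rcases h b c with h3 | h3 <;>
    simp only [h1, h2, h3, one_smul, neg_smul, mul_one, mul_neg, neg_neg] <;> noncomm_ring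

theorem superTrace_apply (X : SuperMat n) :
    superTrace n X = ∑ i, (if idxParity i = 0 then 1 else -1 : ℂ) * X i i := rfl

theorem superTrace_mul_comm {a b : ZMod 2} {X Y : SuperMat n} (hX : X ∈ matPart n a)
    (hY : Y ∈ matPart n b) : superTrace n (X * Y) = superSign a b * superTrace n (Y * X) := by
  simp only [superTrace_apply, Matrix.mul_apply, Finset.mul_sum]
  rw [Finset.sum_comm]
  refine Finset.sum_congr rfl fun j _ => Finset.sum_congr rfl fun i _ => ?_
  by_cases h1 : idxParity i + idxParity j = a
  · by_cases h2 : idxParity j + idxParity i = b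
    · have h : ∀ p : ZMod 2, p = 0 ∨ p = 1 := by decide
      have h11 : (1 + 1 : ZMod 2) = 0 := by decide
      subst h1 h2
      rcases h (idxParity i) with hi | hi <;> rcases h (idxParity j) with hj | hj <;>
        simp [hi, hj, superSign, h11, mul_comm]
    · simp [hY j i h2]
  · simp [hX i j h1]

theorem superTrace_of_odd {X : SuperMat n} (hX : X ∈ matPart n 1) : superTrace n X = 0 := by
  rw [superTrace_apply]
  refine Finset.sum_eq_zero fun i _ => ?_
  have h : ∀ p : ZMod 2, p + p ≠ 1 := by decide
  rw [hX i i (h _), mul_zero]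

theorem superTrace_matBracket (X Y : SuperMat n) : superTrace n (matBracket n X Y) = 0 := by
  simp only [matBracket, LinearMap.mk₂_apply, map_sum]
  refine Finset.sum_eq_zero fun a _ => Finset.sum_eq_zero fun b _ => ?_
  rw [map_sub, map_smul, superTrace_mul_comm (matProj_mem a X) (matProj_mem b Y), smul_eq_mul,
    sub_self]

/-- Extend an identity from homogeneous elements. -/
theorem superMat_induction {P : SuperMat n → Prop} (hadd : ∀ X Y, P X → P Y → P (X + Y))
    (hhom : ∀ a, ∀ X ∈ matPart n a, P X) (X : SuperMat n) : P X := by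
  rw [← matProj_add X]
  exact hadd _ _ (hhom 0 _ (matProj_mem 0 X)) (hhom 1 _ (matProj_mem 1 X))

theorem superTrace_invariant (X Y Z : SuperMat n) :
    superTrace n (matBracket n X Y * Z) = superTrace n (X * matBracket n Y Z) := by
  induction X using superMat_induction with
  | hadd X X' h h' => simp only [map_add, LinearMap.add_apply, add_mul, h, h']
  | hhom a X hX =>
    induction Y using superMat_induction with
    | hadd Y Y' h h' =>
      simp only [map_add, LinearMap.add_apply, add_mul, mul_add, h, h']
    | hhom b Y hY =>
      induction Z using superMat_induction with
      | hadd Z Z' h h' => simp only [map_add, mul_add, h, h']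
      | hhom c Z hZ =>
        rw [matBracket_of_mem hX hY, matBracket_of_mem hY hZ, sub_mul, mul_sub, map_sub, map_sub,
          smul_mul_assoc, mul_smul_comm, map_smul, map_smul, mul_assoc Y X Z,
          superTrace_mul_comm hY (mul_mem_matPart hX hZ), superSign_add, smul_eq_mul, smul_eq_mul,
          superSign_comm b a, ← mul_assoc, ← mul_assoc, superSign_mul_self, one_mul, mul_assoc,
          mul_assoc]

variable (n)

/-- `sl(n|n)`: the supermatrices of supertrace zero. -/
abbrev slSuper : Submodule ℂ (SuperMat n) := LinearMap.ker (superTrace n)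

theorem one_mem_slSuper : (1 : SuperMat n) ∈ slSuper n := by
  have h1 : ∀ i : Fin (2 * n), (if idxParity i = 0 then 1 else -1 : ℂ) * (1 : SuperMat n) i i
      = (fun k : ℕ => if k < n then (1 : ℂ) else -1) i := by
    intro i
    by_cases h : i.val < n <;> simp [idxParity, h]
  rw [LinearMap.mem_ker, superTrace_apply, Finset.sum_congr rfl fun i _ => h1 i,
    Fin.sum_univ_eq_sum_range (fun k : ℕ => if k < n then (1 : ℂ) else -1), two_mul,
    Finset.sum_range_add]
  rw [Finset.sum_congr rfl fun k hk => if_pos (Finset.mem_range.1 hk)]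
  simp

/-- The line spanned by the identity matrix in `sl(n|n)`. -/
abbrev slCenter : Submodule ℂ (slSuper n) := Submodule.span ℂ {⟨1, one_mem_slSuper n⟩}

/-- `psl(n|n)`: the quotient of `sl(n|n)` by the ideal spanned by the identity matrix. -/
abbrev PSL : Type := slSuper n ⧸ slCenter n

/-- The class of a supertraceless matrix in `psl(n|n)`. -/
abbrev pslMk : slSuper n →ₗ[ℂ] PSL n := (slCenter n).mkQ

theorem matBracket_one_left (Y : SuperMat n) : matBracket n 1 Y = 0 := by
  induction Y using superMat_induction with
  | hadd Y Y' h h' => rw [map_add, h, h', add_zero]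
  | hhom b Y hY => simp [matBracket_of_mem one_mem_matPart hY, superSign]

theorem matBracket_one_right (X : SuperMat n) : matBracket n X 1 = 0 := by
  induction X using superMat_induction with
  | hadd X X' h h' => rw [map_add, LinearMap.add_apply, h, h', add_zero]
  | hhom a X hX => simp [matBracket_of_mem hX one_mem_matPart, superSign]

/-- The supercommutator on `sl(n|n)`. -/
def slBracket : slSuper n →ₗ[ℂ] slSuper n →ₗ[ℂ] slSuper n :=
  LinearMap.mk₂ ℂ (fun X Y => ⟨matBracket n X.1 Y.1, superTrace_matBracket X.1 Y.1⟩)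
    (fun _ _ _ => Subtype.ext (by simp)) (fun _ _ _ => Subtype.ext (by simp))
    (fun _ _ _ => Subtype.ext (by simp)) (fun _ _ _ => Subtype.ext (by simp))

/-- The form `(X, Y) ↦ str (X Y)` on `sl(n|n)`. -/
def slForm : slSuper n →ₗ[ℂ] slSuper n →ₗ[ℂ] ℂ :=
  LinearMap.mk₂ ℂ (fun X Y => superTrace n (X.1 * Y.1))
    (fun _ _ _ => by simp [add_mul]) (fun _ _ _ => by simp)
    (fun _ _ _ => by simp [mul_add]) (fun _ _ _ => by simp)

variable {n}

/-- Descend a bilinear map that kills the identity matrix on both sides to `psl(n|n)`. -/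
def pslLift₂ {M : Type} [AddCommGroup M] [Module ℂ M] (f : slSuper n →ₗ[ℂ] slSuper n →ₗ[ℂ] M)
    (hl : ∀ Y, f ⟨1, one_mem_slSuper n⟩ Y = 0) (hr : ∀ X, f X ⟨1, one_mem_slSuper n⟩ = 0) :
    PSL n →ₗ[ℂ] PSL n →ₗ[ℂ] M :=
  ((slCenter n).liftQ
    ((slCenter n).liftQ f (by
      rw [Submodule.span_singleton_le_iff_mem, LinearMap.mem_ker]
      exact LinearMap.ext hl)).flip
    (by
      rw [Submodule.span_singleton_le_iff_mem, LinearMap.mem_ker]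
      refine LinearMap.ext fun q => ?_
      obtain ⟨X, rfl⟩ := Submodule.mkQ_surjective _ q
      simpa using hr X)).flip

@[simp]
theorem pslLift₂_mk {M : Type} [AddCommGroup M] [Module ℂ M]
    (f : slSuper n →ₗ[ℂ] slSuper n →ₗ[ℂ] M) (hl hr) (X Y : slSuper n) :
    pslLift₂ f hl hr (pslMk n X) (pslMk n Y) = f X Y := rfl

variable (n)

/-- The homogeneous part of parity `a` of `psl(n|n)`. -/
def pslPart (a : ZMod 2) : Submodule ℂ (PSL n) :=
  ((matPart n a).comap (slSuper n).subtype).map (pslMk n)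

/-- The bracket of `psl(n|n)`, induced from the supercommutator. -/
def pslBracket : PSL n →ₗ[ℂ] PSL n →ₗ[ℂ] PSL n :=
  pslLift₂ ((slBracket n).compr₂ (pslMk n))
    (fun Y => by
      have : slBracket n ⟨1, one_mem_slSuper n⟩ Y = 0 := Subtype.ext (matBracket_one_left n Y.1)
      rw [LinearMap.compr₂_apply, this, map_zero])
    (fun X => by
      have : slBracket n X ⟨1, one_mem_slSuper n⟩ = 0 := Subtype.ext (matBracket_one_right n X.1)
      rw [LinearMap.compr₂_apply, this, map_zero])

theorem pslPart_isCompl : IsCompl (pslPart n 0) (pslPart n 1) := by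
  constructor
  · rw [Submodule.disjoint_def]
    rintro _ ⟨X, hX, rfl⟩ ⟨Y, hY, hXY⟩
    have h := (Submodule.Quotient.eq (slCenter n)).1 hXY
    obtain ⟨c, hc⟩ := Submodule.mem_span_singleton.1 h
    have hc' : c • (1 : SuperMat n) = Y.1 - X.1 := congrArg Subtype.val hc
    have hY0 : Y.1 ∈ matPart n 0 := by
      rw [show Y.1 = c • (1 : SuperMat n) + X.1 by rw [hc', sub_add_cancel]]
      exact Submodule.add_mem _ (Submodule.smul_mem _ _ one_mem_matPart) hX
    have hz : Y = 0 := by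
      refine Subtype.ext (Matrix.ext fun i j => ?_)
      by_cases hij : idxParity i + idxParity j = 0
      · exact hY i j (by rw [hij]; decide)
      · exact hY0 i j hij
    rw [← hXY, hz, map_zero]
  · rw [codisjoint_iff, eq_top_iff]
    rintro q -
    obtain ⟨X, rfl⟩ := Submodule.mkQ_surjective _ q
    have h1 : matProj n 1 X.1 ∈ slSuper n := superTrace_of_odd (matProj_mem 1 X.1)
    have h0 : matProj n 0 X.1 ∈ slSuper n := by
      rw [show matProj n 0 X.1 = X.1 - matProj n 1 X.1 by
        rw [eq_sub_iff_add_eq, matProj_add]]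
      exact Submodule.sub_mem _ X.2 h1
    refine Submodule.mem_sup.2 ⟨pslMk n ⟨_, h0⟩, ⟨_, matProj_mem 0 X.1, rfl⟩,
      pslMk n ⟨_, h1⟩, ⟨_, matProj_mem 1 X.1, rfl⟩, ?_⟩
    rw [← map_add]
    exact congrArg _ (Subtype.ext (matProj_add X.1))

noncomputable instance : LieSuperalgebra (PSL n) where
  part := pslPart n
  isCompl := pslPart_isCompl n
  bracket := pslBracket n
  bracket_mem := by
    rintro a b _ _ ⟨X, hX, rfl⟩ ⟨Y, hY, rfl⟩
    exact ⟨slBracket n X Y, matBracket_mem hX hY, rfl⟩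
  bracket_skew := by
    rintro a b _ _ ⟨X, hX, rfl⟩ ⟨Y, hY, rfl⟩
    exact congrArg (pslMk n) (Subtype.ext (matBracket_skew hX hY) :
      slBracket n X Y = -(superSign a b • slBracket n Y X))
  jacobi := by
    rintro a b c _ _ _ ⟨X, hX, rfl⟩ ⟨Y, hY, rfl⟩ ⟨Z, hZ, rfl⟩
    exact congrArg (pslMk n) (Subtype.ext (matBracket_jacobi hX hY hZ) :
      slBracket n X (slBracket n Y Z) =
        slBracket n (slBracket n X Y) Z + superSign a b • slBracket n Y (slBracket n X Z))

/-- The invariant form of `psl(n|n)` induced from `(X, Y) ↦ str (X Y)`. -/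
noncomputable def pslForm : InvariantForm (PSL n) where
  form := pslLift₂ (slForm n)
    (fun Y => (congrArg (superTrace n) (one_mul Y.1)).trans Y.2)
    (fun X => (congrArg (superTrace n) (mul_one X.1)).trans X.2)
  even := by
    rintro a b _ _ ⟨X, hX, rfl⟩ ⟨Y, hY, rfl⟩ hab
    have h : ∀ p q : ZMod 2, p ≠ q → p + q = 1 := by decide
    refine superTrace_of_odd (X := X.1 * Y.1) ?_
    rw [← h a b hab]
    exact mul_mem_matPart hX hY
  symm := by
    rintro a b _ _ ⟨X, hX, rfl⟩ ⟨Y, hY, rfl⟩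
    exact superTrace_mul_comm (X := X.1) (Y := Y.1) hX hY
  invariant := by
    intro x y z
    obtain ⟨X, rfl⟩ := Submodule.mkQ_surjective _ x
    obtain ⟨Y, rfl⟩ := Submodule.mkQ_surjective _ y
    obtain ⟨Z, rfl⟩ := Submodule.mkQ_surjective _ z
    exact superTrace_invariant X.1 Y.1 Z.1

/-- The elementary supermatrix `E^{i,j}` with rows and columns numbered `1, …, 2n`. -/
def elemMat (i j : ℕ) : SuperMat n :=
  Matrix.of fun a b => if a.val + 1 = i ∧ b.val + 1 = j then 1 else 0

theorem elemMat_mem {i j : ℕ} (h : i ≠ j) : elemMat n i j ∈ slSuper n := by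
  rw [LinearMap.mem_ker, superTrace_apply]
  refine Finset.sum_eq_zero fun a _ => ?_
  have : ¬(a.val + 1 = i ∧ a.val + 1 = j) := fun h' => h (h'.1.symm.trans h'.2)
  simp [elemMat, this]

/-- The class of `E^{i,j}`, `i ≠ j`, in `psl(n|n)`. -/
def pslE (i j : ℕ) (h : i ≠ j) : PSL n := pslMk n ⟨elemMat n i j, elemMat_mem n h⟩

/-- The positive nilpotent subalgebra of `psl(n|n)`, spanned by the `E^{i,j}` with `i < j`. -/
def pslNilpotent : Submodule ℂ (PSL n) :=
  Submodule.span ℂ {x | ∃ (i j : ℕ) (h : i < j), 1 ≤ i ∧ j ≤ 2 * n ∧ x = pslE n i j h.ne}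

/-! ### The vertex superalgebra `V^1(psl(n|n))` and its vectors -/

/-- The enveloping algebra of the affine Lie superalgebra of `psl(n|n)`. -/
abbrev PSLHat : Type := AffineEnveloping (pslForm n)

/-- `V^1(psl(n|n))`. -/
abbrev VPsl : Type := UniversalAffine (pslForm n) 1

/-- The mode `E^{i,j}_(m)`. -/
noncomputable def modeE (i j : ℕ) (h : i ≠ j) (m : ℤ) : PSLHat n :=
  AffineEnveloping.mode (pslForm n) (pslE n i j h) m

/-- The translation operator `T`. -/
noncomputable def transT : PSLHat n := AffineEnveloping.translation (pslForm n)

/-- The vacuum of `V^1(psl(n|n))`. -/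
noncomputable def vac : VPsl n := vacuum (pslForm n) 1

variable {n}

/-- A vector of `V^1(psl(n|n))` is singular if `n₊ ⊕ t psl(n|n)[t]` annihilates it. -/
def IsSingular (v : VPsl n) : Prop :=
  ∀ u ∈ affineNilpotent (pslForm n) (pslNilpotent n), u • v = 0

/-- `χ = E^{1,2n-1}_(-1) E^{1,2n}_(-1) |0⟩`. -/
noncomputable def chi (hn : 1 < n) : VPsl n :=
  (modeE n 1 (2 * n - 1) (by omega) (-1) * modeE n 1 (2 * n) (by omega) (-1)) • vac n

/-- `χ₊ = (E^{1,n}_(-1))² |0⟩`. -/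
noncomputable def chiPlus (hn : 1 < n) : VPsl n :=
  (modeE n 1 n (by omega) (-1) ^ 2) • vac n

/-- `χ₋ = (E^{n+1,2n}_(-1) E^{n+2,2n-1}_(-1) - E^{n+1,2n-1}_(-1) E^{n+2,2n}_(-1)) |0⟩`. -/
noncomputable def chiMinus (hn : 3 < n) : VPsl n :=
  (modeE n (n + 1) (2 * n) (by omega) (-1) * modeE n (n + 2) (2 * n - 1) (by omega) (-1)
    - modeE n (n + 1) (2 * n - 1) (by omega) (-1) * modeE n (n + 2) (2 * n) (by omega) (-1))
    • vac n

/-- `U = ⟨χ⟩`, the submodule of `V^1(psl(n|n))` generated by `χ`. -/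
noncomputable def submoduleU (hn : 1 < n) : Submodule (PSLHat n) (VPsl n) :=
  Submodule.span (PSLHat n) {chi hn}

end Psl

/-!
The two explicit formulas follow from the commutation relations. As `T` acts as `-d/dt`, one has
`x_(1) T = T x_(1) + x_(0)`. On the vectors `y_(-1) z_(-1) |0⟩` that occur here, `x_(1)` gives
zero, so `x_(1) T` acts as the superderivation `x_(0)`
(`mode_one_mul_translation_smul_modePair`), and the formulas reduce to brackets of elementary
matrices. Membership in `U` is then immediate.

That `χ₊` and `χ₋` are not singular means that a raising operator sends them to a nonzero vector
of `V^1(psl(n|n))`, which needs a lower bound for the size of an induced module. It is obtained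
without a Poincaré-Birkhoff-Witt theorem. For every Lie superalgebra `L` with invariant form and
every level `k`, the affine Lie superalgebra acts on the enveloping algebra `U(t⁻¹ L[t⁻¹])`
(`affineAction`), with negative modes acting by left multiplication, `K` by `k`, and nonnegative
modes and `T` killing `1`. Hence there is a map `V^k(L) → U(t⁻¹ L[t⁻¹])` with `|0⟩ ↦ 1`
(`toNegEnveloping`).

The operators of the remaining modes are determined recursively by moving them to the right
through a word in negative modes. To see that this is well defined, the recursion is written as
an action of `t⁻¹ L[t⁻¹]` on triples made of an element `u` and the prospective values of all
modes and of `T` on it (`negAct_bracket`), and the operators are read off from the orbit of the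
vacuum triple. The affine relations hold on `1`, and they propagate along words
(`modeAct_bracket`, `translationAct_modeAct`).

Finally, `U(t⁻¹ L[t⁻¹])` has small supercommutative quotients: `t⁻² L[t⁻¹]` is an ideal of
`t⁻¹ L[t⁻¹]` with abelian quotient, so an even functional `α` and an odd functional `β` on `L` give a
homomorphism to the dual numbers with `x_(-1) ↦ α(x) + β(x) ε` (`dualNumberMode_bracket`). With
two matrix entries for `α` and `β`, the images of `E^{n,n+1}_(0) χ₊` and `E^{n,n+1}_(0) χ₋` are
`-2 ε` and `ε`.
-/

/-! ### The enveloping algebra of the negative modes -/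

section NegativePart

variable (L : Type) [AddCommGroup L] [Module ℂ L] [LieSuperalgebra L]

/-- The defining relations of the enveloping algebra of `t⁻¹ L[t⁻¹]`. The generator `(x, m)`
stands for `x t ^ (-(m + 1))`, so the bracket of the generators at `m` and `l` sits at
`m + l + 1`, and the central term never occurs. -/
inductive NegRel : FreeAlgebra ℂ (L × ℕ) → FreeAlgebra ℂ (L × ℕ) → Prop
  | add (x y : L) (m : ℕ) : NegRel
      (FreeAlgebra.ι ℂ (x + y, m)) (FreeAlgebra.ι ℂ (x, m) + FreeAlgebra.ι ℂ (y, m))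
  | smul (c : ℂ) (x : L) (m : ℕ) : NegRel
      (FreeAlgebra.ι ℂ (c • x, m)) (c • FreeAlgebra.ι ℂ (x, m))
  | bracket {a b : ZMod 2} {x y : L} (hx : x ∈ LieSuperalgebra.part a)
      (hy : y ∈ LieSuperalgebra.part b) (m l : ℕ) : NegRel
      (FreeAlgebra.ι ℂ (x, m) * FreeAlgebra.ι ℂ (y, l)
        - superSign a b • (FreeAlgebra.ι ℂ (y, l) * FreeAlgebra.ι ℂ (x, m)))
      (FreeAlgebra.ι ℂ (LieSuperalgebra.bracket x y, m + l + 1))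

/-- The enveloping algebra `U(t⁻¹ L[t⁻¹])` of the Lie superalgebra of negative modes. -/
def NegEnveloping : Type := RingQuot (NegRel L)

noncomputable instance : Ring (NegEnveloping L) := inferInstanceAs (Ring (RingQuot (NegRel L)))

noncomputable instance : Algebra ℂ (NegEnveloping L) :=
  inferInstanceAs (Algebra ℂ (RingQuot (NegRel L)))

variable {L}

namespace NegEnveloping

/-- The projection from the free algebra. -/
noncomputable def mk : FreeAlgebra ℂ (L × ℕ) →ₐ[ℂ] NegEnveloping L :=
  RingQuot.mkAlgHom ℂ (NegRel L)

theorem mk_rel {p q : FreeAlgebra ℂ (L × ℕ)} (h : NegRel L p q) : mk p = mk q :=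
  RingQuot.mkAlgHom_rel ℂ h

theorem mk_surjective : Function.Surjective (mk (L := L)) :=
  RingQuot.mkAlgHom_surjective ℂ (NegRel L)

/-- The element `x t ^ (-(m + 1))`, linear in `x`. -/
noncomputable def gen (m : ℕ) : L →ₗ[ℂ] NegEnveloping L where
  toFun x := mk (FreeAlgebra.ι ℂ (x, m))
  map_add' x y := by rw [mk_rel (.add x y m), map_add]
  map_smul' c x := by rw [mk_rel (.smul c x m), map_smul, RingHom.id_apply]

theorem gen_bracket {a b : ZMod 2} {x y : L} (hx : x ∈ LieSuperalgebra.part a)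
    (hy : y ∈ LieSuperalgebra.part b) (m l : ℕ) :
    gen m x * gen l y - superSign a b • (gen l y * gen m x)
      = gen (m + l + 1) (LieSuperalgebra.bracket x y) := by
  have := mk_rel (.bracket hx hy m l)
  rwa [map_sub, map_mul, map_smul, map_mul] at this

/-- The universal property of `U(t⁻¹ L[t⁻¹])`. -/
noncomputable def lift {A : Type} [Ring A] [Algebra ℂ A] (f : ℕ → L →ₗ[ℂ] A)
    (hf : ∀ {a b : ZMod 2} {x y : L}, x ∈ LieSuperalgebra.part a → y ∈ LieSuperalgebra.part b →
      ∀ m l, f m x * f l y - superSign a b • (f l y * f m x)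
        = f (m + l + 1) (LieSuperalgebra.bracket x y)) : NegEnveloping L →ₐ[ℂ] A :=
  RingQuot.liftAlgHom ℂ ⟨FreeAlgebra.lift ℂ fun p : L × ℕ => f p.2 p.1, by
    rintro p q (⟨x, y, m⟩ | ⟨c, x, m⟩ | ⟨hx, hy, m, l⟩)
    · simp
    · simp
    · simpa using hf hx hy m l⟩

theorem lift_gen {A : Type} [Ring A] [Algebra ℂ A] (f : ℕ → L →ₗ[ℂ] A)
    (hf : ∀ {a b : ZMod 2} {x y : L}, x ∈ LieSuperalgebra.part a → y ∈ LieSuperalgebra.part b →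
      ∀ m l, f m x * f l y - superSign a b • (f l y * f m x)
        = f (m + l + 1) (LieSuperalgebra.bracket x y)) (m : ℕ) (x : L) :
    lift f hf (gen m x) = f m x := by
  refine (RingQuot.liftAlgHom_mkAlgHom_apply ℂ _ _ _).trans ?_
  simp

end NegEnveloping

namespace LieSuperalgebra

theorem exists_add_of_parts (x : L) : ∃ x₀ ∈ part (L := L) 0, ∃ x₁ ∈ part (L := L) 1, x₀ + x₁ = x :=
  Submodule.mem_sup.1 (by rw [(isCompl (L := L)).sup_eq_top]; trivial)

/-- The projection of `L` to its odd part. -/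
noncomputable def oddProj : L →ₗ[ℂ] L := (part 1).projection (part 0) isCompl.symm

theorem oddProj_of_mem {a : ZMod 2} {x : L} (hx : x ∈ part a) :
    oddProj x = if a = 1 then x else 0 := by
  have h : ∀ c : ZMod 2, c = 0 ∨ c = 1 := by decide
  rcases h a with rfl | rfl <;> simp [oddProj, hx]

theorem hom_ext {M : Type} [AddCommGroup M] [Module ℂ M] {f g : L →ₗ[ℂ] M}
    (h : ∀ a, ∀ x ∈ part (L := L) a, f x = g x) : f = g := by
  ext x
  obtain ⟨x₀, h₀, x₁, h₁, rfl⟩ := exists_add_of_parts x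
  rw [map_add, map_add, h 0 x₀ h₀, h 1 x₁ h₁]

end LieSuperalgebra

open LieSuperalgebra in
/-- `U(t⁻¹ L[t⁻¹])` is spanned by words in homogeneous generators, built from `1` by left
multiplication. -/
theorem NegEnveloping.induction {P : NegEnveloping L → Prop} (one : P 1)
    (add : ∀ u v, P u → P v → P (u + v)) (smul : ∀ (c : ℂ) u, P u → P (c • u))
    (gen_mul : ∀ (a : ZMod 2) (z : L), z ∈ part a → ∀ r u, P u → P (gen r z * u))
    (u : NegEnveloping L) : P u := by
  suffices h : ∀ (p : FreeAlgebra ℂ (L × ℕ)) (v : NegEnveloping L), P v → P (mk p * v) by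
    obtain ⟨p, rfl⟩ := mk_surjective u
    simpa using h p 1 one
  intro p
  induction p using FreeAlgebra.induction with
  | grade0 c =>
    intro v hv
    rw [AlgHom.commutes, ← Algebra.smul_def]
    exact smul c v hv
  | grade1 p =>
    intro v hv
    obtain ⟨x, r⟩ := p
    obtain ⟨x₀, h₀, x₁, h₁, rfl⟩ := exists_add_of_parts x
    change P (gen r (x₀ + x₁) * v)
    rw [map_add, add_mul]
    exact add _ _ (gen_mul 0 x₀ h₀ r v hv) (gen_mul 1 x₁ h₁ r v hv)
  | mul p q hp hq =>
    intro v hv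
    rw [map_mul, mul_assoc]
    exact hp _ (hq v hv)
  | add p q hp hq =>
    intro v hv
    rw [map_add, add_mul]
    exact add _ _ (hp v hv) (hq v hv)

end NegativePart

/-! ### The action of the affine Lie superalgebra on `U(t⁻¹ L[t⁻¹])` -/

section VacuumModule

open LieSuperalgebra NegEnveloping

variable {L : Type} [AddCommGroup L] [Module ℂ L] [LieSuperalgebra L]

theorem superSign_eq_one_or (a b : ZMod 2) : superSign a b = 1 ∨ superSign a b = -1 := by
  unfold superSign
  split_ifs <;> simp

/-- The central term `m δ_{m + l, 0} k (x, y)` of the bracket of `x t ^ m` and `y t ^ l` at level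
`k`. -/
noncomputable def affineCocycle (B : InvariantForm L) (k : ℂ) (m l : ℤ) : L →ₗ[ℂ] L →ₗ[ℂ] ℂ :=
  (if m + l = 0 then (m : ℂ) * k else 0) • B.form

theorem affineCocycle_eq_zero (B : InvariantForm L) (k : ℂ) (m l : ℤ) {a b : ZMod 2} {x y : L}
    (hx : x ∈ part a) (hy : y ∈ part b) (hab : a ≠ b) : affineCocycle B k m l x y = 0 := by
  rw [affineCocycle, LinearMap.smul_apply, LinearMap.smul_apply, B.even hx hy hab, smul_zero]

theorem affineCocycle_skew (B : InvariantForm L) (k : ℂ) (m l : ℤ) {a b : ZMod 2} {x y : L}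
    (hx : x ∈ part a) (hy : y ∈ part b) :
    affineCocycle B k m l x y = -(superSign a b * affineCocycle B k l m y x) := by
  by_cases h : m + l = 0
  · have hl : (l : ℂ) = -m := by
      rw [eq_neg_iff_add_eq_zero, add_comm]
      exact_mod_cast h
    simp only [affineCocycle, h, add_comm l m, if_true, LinearMap.smul_apply, smul_eq_mul,
      B.symm hx hy, hl]
    ring
  · simp [affineCocycle, h, add_comm l m]

/-- The cocycle identity of the central term, which is what the invariance of the form gives. -/
theorem affineCocycle_bracket (B : InvariantForm L) (k : ℂ) (m l r : ℤ) {b c : ZMod 2} (x : L)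
    {y z : L} (hy : y ∈ part b) (hz : z ∈ part c) :
    affineCocycle B k m (l + r) x (bracket y z) = affineCocycle B k (m + l) r (bracket x y) z
      - superSign b c * affineCocycle B k (m + r) l (bracket x z) y := by
  simp only [affineCocycle, add_right_comm m r l, ← add_assoc, LinearMap.smul_apply, B.invariant,
    smul_eq_mul]
  by_cases h : m + l + r = 0
  · have hm : (m : ℂ) = -l - r := by
      have : (m : ℂ) + l + r = 0 := by exact_mod_cast h
      linear_combination this
    simp only [h, if_true, bracket_skew hz hy, map_neg, map_smul, smul_eq_mul, superSign_comm c b]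
    push_cast
    rw [hm]
    linear_combination (l * k * B.form x (bracket y z)) * superSign_mul_self b c
  · simp [h]

/-- The Jacobi identity, with `[x, [y, z]]` written in left-nested brackets. -/
theorem bracket_bracket_sub {a b c : ZMod 2} {x y z : L} (hx : x ∈ part a) (hy : y ∈ part b)
    (hz : z ∈ part c) :
    bracket x (bracket y z)
      = bracket (bracket x y) z - superSign b c • bracket (bracket x z) y := by
  rw [jacobi hx hy hz, bracket_skew (bracket_mem hx hz) hy, superSign_comm (a + c) b,
    superSign_add, smul_neg, smul_smul, sub_neg_eq_add, mul_comm (superSign b a), ← mul_assoc,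
    superSign_mul_self, one_mul, superSign_comm b a]

/-- A triple `(u, f, t)`: an element `u` of `U(t⁻¹ L[t⁻¹])` together with candidates `f m x` for
the value of `x t ^ m` on `u` and `t` for the value of `T` on `u`. -/
abbrev ModeData (L : Type) [AddCommGroup L] [Module ℂ L] [LieSuperalgebra L] : Type :=
  NegEnveloping L × (ℤ → L →ₗ[ℂ] NegEnveloping L) × NegEnveloping L

/-- The map `x ↦ (-1)^(|x| |y|) y t ^ (-(l + 1)) f(x)`. The sign is produced by subtracting twice
the part in which `x` and `y` are both odd, which keeps the expression linear in `x` and `y`. -/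
noncomputable def signedMul (l : ℕ) (y : L) (f : L →ₗ[ℂ] NegEnveloping L) :
    L →ₗ[ℂ] NegEnveloping L where
  toFun x := gen l y * f x - (2 : ℂ) • (gen l (oddProj y) * f (oddProj x))
  map_add' x x' := by
    simp only [map_add, mul_add, smul_add]
    abel
  map_smul' c x := by
    simp only [map_smul, mul_smul_comm, RingHom.id_apply, smul_sub, smul_comm c (2 : ℂ)]

theorem signedMul_apply (l : ℕ) {a b : ZMod 2} {x y : L} (hx : x ∈ part a) (hy : y ∈ part b)
    (f : L →ₗ[ℂ] NegEnveloping L) :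
    signedMul l y f x = superSign a b • (gen l y * f x) := by
  have h : ∀ c : ZMod 2, c = 0 ∨ c = 1 := by decide
  simp only [signedMul, LinearMap.coe_mk, AddHom.coe_mk, oddProj_of_mem hx, oddProj_of_mem hy]
  rcases h a with rfl | rfl <;> rcases h b with rfl | rfl <;> simp [superSign]
  module

/-- The action of `y t ^ (-(l + 1))` on triples `(u, f, t)`. It is left multiplication on `u`,
and on `f` and `t` it is forced by the commutation relations of `x t ^ m` and `T` with
`y t ^ (-(l + 1))`. Up to the
central term, the action on `f` is the tensor product of left multiplication with the coadjoint
action. -/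
noncomputable def negAct (B : InvariantForm L) (k : ℂ) (l : ℕ) :
    L →ₗ[ℂ] Module.End ℂ (ModeData L) :=
  LinearMap.mk₂ ℂ
    (fun y e => (gen l y * e.1,
      fun m => e.2.1 (m + Int.negSucc l) ∘ₗ bracket.flip y
        + ((affineCocycle B k m (Int.negSucc l)).flip y).smulRight e.1
        + signedMul l y (e.2.1 m),
      ((l + 1 : ℕ) : ℂ) • (gen (l + 1) y * e.1) + gen l y * e.2.2))
    (by
      intro y y' e
      refine Prod.ext (by simp [add_mul]) (Prod.ext (funext fun m => LinearMap.ext fun x => ?_) ?_)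
      · simp [signedMul, add_mul, add_smul]
        abel
      · simp [add_mul]
        module)
    (by
      intro c y e
      refine Prod.ext (by simp) (Prod.ext (funext fun m => LinearMap.ext fun x => ?_) ?_)
      · simp [signedMul]
        module
      · simp
        module)
    (by
      intro y e e'
      refine Prod.ext (by simp [mul_add]) (Prod.ext (funext fun m => LinearMap.ext fun x => ?_) ?_)
      · simp [signedMul, mul_add]
        module
      · simp [mul_add]
        module)
    (by
      intro c y e
      refine Prod.ext (by simp) (Prod.ext (funext fun m => LinearMap.ext fun x => ?_) ?_)
      · simp [signedMul]
        module
      · simp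
        module)

section

variable (B : InvariantForm L) (k : ℂ)

@[simp]
theorem negAct_fst (l : ℕ) (y : L) (e : ModeData L) : (negAct B k l y e).1 = gen l y * e.1 := rfl

theorem negAct_mode (l : ℕ) {a b : ZMod 2} {x y : L} (hx : x ∈ part a) (hy : y ∈ part b)
    (e : ModeData L) (m : ℤ) :
    (negAct B k l y e).2.1 m x = e.2.1 (m + Int.negSucc l) (bracket x y)
      + affineCocycle B k m (Int.negSucc l) x y • e.1 + superSign a b • (gen l y * e.2.1 m x) := by
  rw [← signedMul_apply l hx hy]
  rfl

@[simp]
theorem negAct_translation (l : ℕ) (y : L) (e : ModeData L) :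
    (negAct B k l y e).2.2 = ((l + 1 : ℕ) : ℂ) • (gen (l + 1) y * e.1) + gen l y * e.2.2 := rfl

/-- The operators `negAct` satisfy the relations of `t⁻¹ L[t⁻¹]`. In the component of modes this
is the Jacobi identity together with the cocycle identity. -/
theorem negAct_bracket {a b : ZMod 2} {y z : L} (hy : y ∈ part a) (hz : z ∈ part b) (l r : ℕ) :
    negAct B k l y * negAct B k r z - superSign a b • (negAct B k r z * negAct B k l y)
      = negAct B k (l + r + 1) (bracket y z) := by
  have hlr : Int.negSucc (l + r + 1) = Int.negSucc l + Int.negSucc r := by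
    simp only [Int.negSucc_eq]; push_cast; ring
  refine LinearMap.ext fun e => Prod.ext ?_ (Prod.ext (funext fun m => hom_ext fun c x hx => ?_) ?_)
  · simp [← gen_bracket hy hz, sub_mul, mul_assoc]
  · simp only [LinearMap.sub_apply, LinearMap.smul_apply, Module.End.mul_apply, Prod.snd_sub,
      Prod.fst_sub, Prod.smul_snd, Prod.smul_fst, Pi.sub_apply, Pi.smul_apply]
    rw [negAct_mode B k l hx hy, negAct_mode B k r hx hz, negAct_mode B k r hx hz,
      negAct_mode B k r (bracket_mem hx hy) hz, negAct_mode B k l hx hy,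
      negAct_mode B k l (bracket_mem hx hz) hy, negAct_mode B k _ hx (bracket_mem hy hz),
      hlr, affineCocycle_bracket B k m _ _ x hy hz, bracket_bracket_sub hx hy hz,
      ← gen_bracket hy hz, superSign_comm (c + a) b, superSign_comm (c + b) a, superSign_add,
      superSign_add, superSign_add, superSign_comm b c, superSign_comm a c, superSign_comm b a]
    simp only [← add_assoc, add_right_comm m (Int.negSucc r) (Int.negSucc l), negAct_fst, mul_add,
      sub_mul, map_sub, map_smul, smul_add, smul_sub, sub_smul, mul_smul_comm,
      smul_mul_assoc, mul_assoc]
    -- The central terms need equal parities, and then the signs in front of them cancel.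
    by_cases hca : c = a
    · by_cases hcb : c = b
      · subst hca hcb
        rcases superSign_eq_one_or c c with h | h <;> simp only [h] <;> module
      · subst hca
        rw [affineCocycle_eq_zero B k _ _ hx hz hcb]
        rcases superSign_eq_one_or c c with h | h <;>
          rcases superSign_eq_one_or c b with h' | h' <;>
          simp only [h, h'] <;> module
    · rw [affineCocycle_eq_zero B k _ _ hx hy hca]
      by_cases hcb : c = b
      · subst hcb
        rw [superSign_comm a c]
        rcases superSign_eq_one_or c c with h | h <;>
          rcases superSign_eq_one_or c a with h' | h' <;>
          simp only [h, h'] <;> module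
      · rw [affineCocycle_eq_zero B k _ _ hx hz hcb]
        rcases superSign_eq_one_or a b with h | h <;>
          rcases superSign_eq_one_or c b with h' | h' <;>
          rcases superSign_eq_one_or c a with h'' | h'' <;>
          simp only [h, h', h''] <;> module
  -- `T` shifts either factor of the bracket by one, with coefficients adding up to `l + r + 2`.
  · have h1 := gen_bracket hy hz (l + 1) r
    have h2 := gen_bracket hy hz l (r + 1)
    rw [show l + 1 + r + 1 = l + r + 1 + 1 by ring] at h1
    rw [show l + (r + 1) + 1 = l + r + 1 + 1 by ring] at h2
    have h3 : gen (l + r + 1) (bracket y z) * e.2.2 = _ :=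
      congrArg (· * e.2.2) (gen_bracket hy hz l r).symm
    have h4 : ((l + r + 1 + 1 : ℕ) : ℂ) • (gen (l + r + 1 + 1) (bracket y z) * e.1)
      = ((l + 1 : ℕ) : ℂ) • (gen (l + r + 1 + 1) (bracket y z) * e.1)
        + ((r + 1 : ℕ) : ℂ) • (gen (l + r + 1 + 1) (bracket y z) * e.1) := by
      rw [← add_smul]; congr 1; push_cast; ring
    simp only [LinearMap.sub_apply, LinearMap.smul_apply, Module.End.mul_apply, Prod.snd_sub,
      Prod.smul_snd, negAct_translation, negAct_fst]
    rw [h4, h3]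
    nth_rewrite 1 [← h1]
    rw [← h2]
    simp only [mul_add, sub_mul, mul_smul_comm, smul_mul_assoc, mul_assoc]
    module

/-- The action of `U(t⁻¹ L[t⁻¹])` on triples. -/
noncomputable def modeDataAction : NegEnveloping L →ₐ[ℂ] Module.End ℂ (ModeData L) :=
  NegEnveloping.lift (A := Module.End ℂ (ModeData L)) (negAct B k)
    fun hx hy m l => negAct_bracket B k hx hy m l

/-- The triple of the vacuum: `x t ^ m` with `0 ≤ m` and `T` kill it, and the negative modes act
by multiplication. -/
noncomputable def vacuumData : ModeData L :=
  (1, fun m => match m with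
    | Int.ofNat _ => 0
    | Int.negSucc l => gen l, 0)

/-- The orbit `u ↦ u · vacuumData`. Its components record `u`, the values `x t ^ m · u` and
`T · u`. -/
noncomputable def orbitMap : NegEnveloping L →ₗ[ℂ] ModeData L :=
  LinearMap.applyₗ vacuumData ∘ₗ (modeDataAction B k).toLinearMap

theorem orbitMap_one : orbitMap B k (1 : NegEnveloping L) = vacuumData := by
  simp [orbitMap]

theorem orbitMap_gen_mul (l : ℕ) (y : L) (u : NegEnveloping L) :
    orbitMap B k (gen l y * u) = negAct B k l y (orbitMap B k u) := by
  simp [orbitMap, modeDataAction, lift_gen]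

@[simp]
theorem orbitMap_fst (u : NegEnveloping L) : (orbitMap B k u).1 = u := by
  induction u using NegEnveloping.induction with
  | one => rw [orbitMap_one]; rfl
  | add u v hu hv => simp [hu, hv]
  | smul c u hu => simp [hu]
  | gen_mul a z hz r u hu => simp [orbitMap_gen_mul, hu]

/-- The operator of `x t ^ m` on `U(t⁻¹ L[t⁻¹])`. -/
noncomputable def modeAct (m : ℤ) : L →ₗ[ℂ] Module.End ℂ (NegEnveloping L) :=
  LinearMap.mk₂ ℂ (fun x u => (orbitMap B k u).2.1 m x) (by simp) (by simp) (by simp) (by simp)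

/-- The operator of `T` on `U(t⁻¹ L[t⁻¹])`. -/
noncomputable def translationAct : Module.End ℂ (NegEnveloping L) where
  toFun u := (orbitMap B k u).2.2
  map_add' u v := by simp
  map_smul' c u := by simp

theorem modeAct_gen_mul {a b : ZMod 2} {x y : L} (hx : x ∈ part a) (hy : y ∈ part b) (m : ℤ)
    (l : ℕ) (u : NegEnveloping L) :
    modeAct B k m x (gen l y * u) = modeAct B k (m + Int.negSucc l) (bracket x y) u
      + affineCocycle B k m (Int.negSucc l) x y • u
      + superSign a b • (gen l y * modeAct B k m x u) := by
  have := negAct_mode B k l hx hy (orbitMap B k u) m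
  rwa [← orbitMap_gen_mul, orbitMap_fst] at this

theorem modeAct_one_of_nonneg (m : ℤ) (hm : 0 ≤ m) (x : L) : modeAct B k m x 1 = 0 := by
  change (orbitMap B k 1).2.1 m x = 0
  obtain ⟨m, rfl⟩ := Int.eq_ofNat_of_zero_le hm
  rw [orbitMap_one]
  rfl

theorem modeAct_negSucc_one (l : ℕ) (x : L) : modeAct B k (Int.negSucc l) x 1 = gen l x := by
  change (orbitMap B k 1).2.1 (Int.negSucc l) x = gen l x
  rw [orbitMap_one]
  rfl

theorem affineCocycle_negSucc (l r : ℕ) (x y : L) :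
    affineCocycle B k (Int.negSucc l) (Int.negSucc r) x y = 0 := by
  have : Int.negSucc l + Int.negSucc r ≠ 0 := by omega
  simp [affineCocycle, this]

/-- The negative modes act by left multiplication. -/
theorem modeAct_negSucc (l : ℕ) (x : L) (u : NegEnveloping L) :
    modeAct B k (Int.negSucc l) x u = gen l x * u := by
  suffices ∀ l (a : ZMod 2) (x : L), x ∈ part a → modeAct B k (Int.negSucc l) x u = gen l x * u by
    exact LinearMap.congr_fun (f := (modeAct B k (Int.negSucc l)).flip u)
      (g := (LinearMap.mul ℂ (NegEnveloping L)).flip u ∘ₗ gen l) (hom_ext (this l)) x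
  induction u using NegEnveloping.induction with
  | one => intro l a x _; rw [modeAct_negSucc_one, mul_one]
  | add u v hu hv => intro l a x hx; rw [map_add, hu l a x hx, hv l a x hx, mul_add]
  | smul c u hu => intro l a x hx; rw [map_smul, hu l a x hx, mul_smul_comm]
  | gen_mul b z hz r u hu =>
    intro l a x hx
    have hlr : Int.negSucc l + Int.negSucc r = Int.negSucc (l + r + 1) := by
      simp only [Int.negSucc_eq]; push_cast; ring
    rw [modeAct_gen_mul B k hx hz, hu l a x hx, hlr, hu _ _ _ (bracket_mem hx hz),
      affineCocycle_negSucc, ← gen_bracket hx hz]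
    simp only [sub_mul, smul_mul_assoc, mul_assoc]
    module

theorem translationAct_one : translationAct B k (1 : NegEnveloping L) = 0 := by
  change (orbitMap B k 1).2.2 = 0
  rw [orbitMap_one]
  rfl

theorem translationAct_gen_mul (l : ℕ) (y : L) (u : NegEnveloping L) :
    translationAct B k (gen l y * u)
      = ((l + 1 : ℕ) : ℂ) • (gen (l + 1) y * u) + gen l y * translationAct B k u := by
  have := negAct_translation B k l y (orbitMap B k u)
  rwa [← orbitMap_gen_mul, orbitMap_fst] at this

/-- The mode operators satisfy the affine commutation relations at level `k`. The relation passes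
from `u` to `z t ^ (-(r + 1)) u` because it holds when one of the modes is negative. -/
theorem modeAct_bracket {a b : ZMod 2} {x y : L} (hx : x ∈ part a) (hy : y ∈ part b) (m l : ℤ)
    (u : NegEnveloping L) :
    modeAct B k m x (modeAct B k l y u) - superSign a b • modeAct B k l y (modeAct B k m x u)
      = modeAct B k (m + l) (bracket x y) u + affineCocycle B k m l x y • u := by
  induction u using NegEnveloping.induction generalizing a b x y m l with
  | one =>
    have neg (r : ℕ) {a b : ZMod 2} {x y : L} (hx : x ∈ part a) (hy : y ∈ part b) (m : ℤ) :
        modeAct B k m x (modeAct B k (Int.negSucc r) y 1)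
          - superSign a b • modeAct B k (Int.negSucc r) y (modeAct B k m x 1)
        = modeAct B k (m + Int.negSucc r) (bracket x y) 1
          + affineCocycle B k m (Int.negSucc r) x y • (1 : NegEnveloping L) := by
      rw [modeAct_negSucc, modeAct_negSucc, modeAct_gen_mul B k hx hy]
      abel
    rcases l with l | l
    · rcases m with m | m
      -- For nonnegative modes the central term could only occur at `m = l = 0`, where it has
      -- the factor `m = 0`.
      · have h : affineCocycle B k (Int.ofNat m) (Int.ofNat l) x y = 0 := by
          by_cases h : Int.ofNat m + Int.ofNat l = 0
          · have : m = 0 := by simp at h; omega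
            simp [affineCocycle, this]
          · simp only [affineCocycle, h]; simp
        rw [modeAct_one_of_nonneg B k (.ofNat l) (by simp),
          modeAct_one_of_nonneg B k (.ofNat m) (by simp),
          modeAct_one_of_nonneg B k (.ofNat m + .ofNat l) (by simp; omega), h]
        simp
      · have := neg m hy hx (.ofNat l)
        rw [affineCocycle_skew B k _ _ hx hy, bracket_skew hx hy, add_comm (Int.negSucc m)]
        rw [superSign_comm b a, sub_eq_iff_eq_add] at this
        rw [this]
        simp only [map_neg, map_smul, LinearMap.neg_apply, LinearMap.smul_apply]
        rcases superSign_eq_one_or a b with h | h <;> simp only [h] <;> module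
    · exact neg l hx hy m
  | add u v hu hv =>
    have h1 := hu hx hy m l
    have h2 := hv hx hy m l
    rw [sub_eq_iff_eq_add] at h1 h2
    simp only [map_add, h1, h2]
    module
  | smul c u hu =>
    have h1 := hu hx hy m l
    simp only [map_smul, smul_comm _ c, ← smul_sub, ← smul_add, h1]
  | gen_mul c z hz r u hu =>
    have hxy := hu hx hy m l
    have hxz := hu (bracket_mem hx hz) hy (m + Int.negSucc r) l
    have hyz := hu hx (bracket_mem hy hz) m (l + Int.negSucc r)
    rw [affineCocycle_bracket B k m _ _ x hy hz, bracket_bracket_sub hx hy hz] at hyz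
    rw [sub_eq_iff_eq_add] at hxy hxz hyz
    rw [modeAct_gen_mul B k hx hz, modeAct_gen_mul B k hy hz,
      modeAct_gen_mul B k (bracket_mem hx hy) hz]
    simp only [map_add, map_smul]
    rw [modeAct_gen_mul B k hx hz, modeAct_gen_mul B k hy hz, hxy, hxz, hyz,
      superSign_comm (a + c) b, superSign_comm (a + b) c, superSign_add, superSign_add,
      superSign_add, superSign_comm c b, superSign_comm c a, superSign_comm b a]
    simp only [← add_assoc, add_right_comm m (Int.negSucc r) l, mul_add, map_sub, map_smul,
      LinearMap.sub_apply, LinearMap.smul_apply, smul_add, sub_smul, mul_smul_comm]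
    -- As for `negAct_bracket`, the central terms need equal parities.
    by_cases hab : a = b
    · subst hab
      by_cases hac : a = c
      · subst hac
        rcases superSign_eq_one_or a a with h | h <;> simp only [h] <;> module
      · rw [affineCocycle_eq_zero B k _ _ hx hz hac, affineCocycle_eq_zero B k _ _ hy hz hac]
        rcases superSign_eq_one_or a a with h | h <;>
          rcases superSign_eq_one_or a c with h' | h' <;>
          simp only [h, h'] <;> module
    · rw [affineCocycle_eq_zero B k _ _ hx hy hab]
      by_cases hbc : b = c
      · subst hbc
        rw [affineCocycle_eq_zero B k _ _ hx hz hab]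
        rcases superSign_eq_one_or a b with h | h <;>
          rcases superSign_eq_one_or b b with h' | h' <;>
          simp only [h, h'] <;> module
      · rw [affineCocycle_eq_zero B k _ _ hy hz hbc]
        by_cases hac : a = c
        · subst hac
          rw [superSign_comm b a]
          rcases superSign_eq_one_or a b with h | h <;>
            rcases superSign_eq_one_or a a with h' | h' <;> simp only [h, h'] <;> module
        · rw [affineCocycle_eq_zero B k _ _ hx hz hac]
          rcases superSign_eq_one_or a b with h | h <;>
            rcases superSign_eq_one_or b c with h' | h' <;>
            rcases superSign_eq_one_or a c with h'' | h'' <;> simp only [h, h', h''] <;> module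

theorem translationAct_modeAct {a : ZMod 2} {x : L} (hx : x ∈ part a) (m : ℤ)
    (u : NegEnveloping L) :
    translationAct B k (modeAct B k m x u) - modeAct B k m x (translationAct B k u)
      = -(m : ℂ) • modeAct B k (m - 1) x u := by
  induction u using NegEnveloping.induction generalizing a x m with
  | one =>
    rw [translationAct_one, map_zero, sub_zero]
    rcases m with m | m
    · rw [modeAct_one_of_nonneg B k (.ofNat m) (by simp), map_zero]
      rcases m with - | m
      · simp
      · rw [modeAct_one_of_nonneg B k _ (by simp), smul_zero]
    · rw [modeAct_negSucc, translationAct_gen_mul, translationAct_one, mul_zero, add_zero,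
        show Int.negSucc m - 1 = Int.negSucc (m + 1) by omega, modeAct_negSucc, Int.cast_negSucc,
        neg_neg]
  | add u v hu hv =>
    have h1 := hu hx m
    have h2 := hv hx m
    rw [sub_eq_iff_eq_add] at h1 h2
    simp only [map_add, h1, h2]
    module
  | smul c u hu =>
    have h1 := hu hx m
    simp only [map_smul, smul_comm _ c, ← smul_sub, h1]
  | gen_mul c z hz r u hu =>
    have h1 := hu hx m
    have h2 := hu (bracket_mem hx hz) (m + Int.negSucc r)
    rw [sub_eq_iff_eq_add] at h1 h2
    have e1 : m + Int.negSucc r - 1 = m - 1 + Int.negSucc r := by ring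
    have e2 : m + Int.negSucc (r + 1) = m - 1 + Int.negSucc r := by omega
    -- Both sides are supported at `m = r + 2`, with coefficient `(r + 1) (r + 2)`.
    have hc : (m : ℂ) • affineCocycle B k (m - 1) (Int.negSucc r) x z
        = ((r + 1 : ℕ) : ℂ) • affineCocycle B k m (Int.negSucc (r + 1)) x z := by
      simp only [affineCocycle, e2]
      by_cases h : m - 1 + Int.negSucc r = 0
      · have : m = r + 2 := by omega
        subst this
        simp only [h, if_true, LinearMap.smul_apply, smul_eq_mul]
        push_cast
        ring
      · simp [h]
    rw [modeAct_gen_mul B k hx hz, translationAct_gen_mul]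
    simp only [map_add, map_smul, translationAct_gen_mul, modeAct_gen_mul B k hx hz, h1, h2, e1, e2,
      mul_add, smul_add, smul_smul, mul_smul_comm]
    simp only [smul_eq_mul] at hc
    rw [neg_mul, hc, Int.cast_add, Int.cast_negSucc]
    module

/-! ### From the vacuum module to `U(t⁻¹ L[t⁻¹])` -/

/-- The operators by which the generators act on `U(t⁻¹ L[t⁻¹])`, with `K` acting by `k`. -/
noncomputable def genAct : AffineGen L → Module.End ℂ (NegEnveloping L)
  | .mode x m => modeAct B k m x
  | .central => k • 1
  | .translation => translationAct B k

/-- `U(t⁻¹ L[t⁻¹])` as a module over the affine Lie superalgebra at level `k`. -/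
noncomputable def affineAction : AffineEnveloping B →ₐ[ℂ] Module.End ℂ (NegEnveloping L) :=
  RingQuot.liftAlgHom ℂ ⟨FreeAlgebra.lift ℂ (genAct B k), by
    have hT (x : L) (m : ℤ) : translationAct B k * modeAct B k m x
        - modeAct B k m x * translationAct B k = -(m : ℂ) • modeAct B k (m - 1) x := by
      refine LinearMap.ext fun u => ?_
      have : (translationAct B k ∘ₗ (modeAct B k m).flip u)
          - (modeAct B k m).flip (translationAct B k u)
          = -(m : ℂ) • (modeAct B k (m - 1)).flip u :=
        hom_ext fun a x hx => translationAct_modeAct B k hx m u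
      exact LinearMap.congr_fun this x
    rintro p q (⟨x, y, m⟩ | ⟨c, x, m⟩ | ⟨hx, hy, m, l⟩ | ⟨x, m⟩ | _ | ⟨x, m⟩)
    · simp [genAct]
    · simp [genAct]
    · refine LinearMap.ext fun u => ?_
      have h := modeAct_bracket B k hx hy m l u
      by_cases hml : m + l = 0
      · simpa [genAct, affineCocycle, hml, smul_smul, mul_right_comm] using h
      · simpa [genAct, affineCocycle, hml] using h
    · simp [genAct]
    · simp [genAct]
    · simp only [map_sub, map_mul, map_smul, FreeAlgebra.lift_ι_apply]
      exact hT x m⟩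

theorem affineAction_of (g : AffineGen L) :
    affineAction B k (AffineEnveloping.of B g) = genAct B k g := by
  refine (RingQuot.liftAlgHom_mkAlgHom_apply ℂ _ _ _).trans ?_
  simp

/-- The map `V^k(L) → U(t⁻¹ L[t⁻¹])` that sends the vacuum to `1`. -/
noncomputable def toNegEnveloping : UniversalAffine B k →+ NegEnveloping L :=
  QuotientAddGroup.lift (vacuumIdeal B k).toAddSubgroup
    (LinearMap.applyₗ (1 : NegEnveloping L) ∘ₗ (affineAction B k).toLinearMap).toAddMonoidHom <| by
    intro p hp
    change affineAction B k p 1 = 0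
    refine Submodule.span_induction (p := fun p _ => affineAction B k p 1 = 0) ?_ ?_ ?_ ?_ hp
    · rintro _ (⟨x, m, hm, rfl⟩ | rfl | rfl)
      · rw [AffineEnveloping.mode, affineAction_of]
        exact modeAct_one_of_nonneg B k m hm x
      · rw [map_sub, AlgHom.commutes, AffineEnveloping.central, affineAction_of, genAct,
          Algebra.algebraMap_eq_smul_one, sub_self, LinearMap.zero_apply]
      · rw [AffineEnveloping.translation, affineAction_of]
        exact translationAct_one B k
    · simp
    · intro p q _ _ hp hq
      rw [map_add, LinearMap.add_apply, hp, hq, add_zero]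
    · intro r p _ hp
      rw [smul_eq_mul, map_mul, Module.End.mul_apply, hp, map_zero]

theorem toNegEnveloping_smul_vacuum (p : AffineEnveloping B) :
    toNegEnveloping B k (p • vacuum B k) = affineAction B k p 1 := by
  have : p • vacuum B k = Submodule.Quotient.mk p := by
    rw [vacuum, ← Submodule.Quotient.mk_smul, smul_eq_mul, mul_one]
  rw [this]
  rfl

theorem toNegEnveloping_mode_mul_mode (x y : L) :
    toNegEnveloping B k ((AffineEnveloping.mode B x (-1) * AffineEnveloping.mode B y (-1))
      • vacuum B k) = gen 0 x * gen 0 y := by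
  rw [toNegEnveloping_smul_vacuum, map_mul, AffineEnveloping.mode, AffineEnveloping.mode,
    affineAction_of, affineAction_of, Module.End.mul_apply]
  change modeAct B k (Int.negSucc 0) x (modeAct B k (Int.negSucc 0) y 1) = _
  rw [modeAct_negSucc, modeAct_negSucc, mul_one]

/-! ### Detecting quadratic vectors by dual numbers -/

/-- The map `x ↦ α(x) + β(x) ε` on the modes `x t ^ (-1)`, and zero on all lower modes. -/
noncomputable def dualNumberMode (α β : L →ₗ[ℂ] ℂ) (m : ℕ) : L →ₗ[ℂ] DualNumber ℂ :=
  if m = 0 then Algebra.linearMap ℂ (DualNumber ℂ) ∘ₗ α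
    + (LinearMap.toSpanSingleton ℂ (DualNumber ℂ) DualNumber.eps) ∘ₗ β else 0

/-- If `α` is even and `β` is odd, `x ↦ α(x) + β(x) ε` takes supercommuting values, since
products of odd elements have a factor `ε ^ 2 = 0`. All brackets of negative modes lie in
`t ^ (-2)` and below, where the map vanishes, so it respects the relations of `t⁻¹ L[t⁻¹]`. -/
theorem dualNumberMode_bracket {α β : L →ₗ[ℂ] ℂ} (hα : ∀ x ∈ part (L := L) 1, α x = 0)
    (hβ : ∀ x ∈ part (L := L) 0, β x = 0) {a b : ZMod 2} {x y : L} (hx : x ∈ part a)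
    (hy : y ∈ part b) (m l : ℕ) :
    dualNumberMode α β m x * dualNumberMode α β l y
      - superSign a b • (dualNumberMode α β l y * dualNumberMode α β m x)
      = dualNumberMode α β (m + l + 1) (bracket x y) := by
  by_cases hm : m = 0
  · by_cases hl : l = 0
    · subst hm hl
      have h : ∀ c : ZMod 2, c = 0 ∨ c = 1 := by decide
      rcases h a with rfl | rfl <;> rcases h b with rfl | rfl <;>
        simp [dualNumberMode, superSign, hα, hβ, hx, hy, Algebra.algebraMap_eq_smul_one,
          smul_comm (β _) (α _), smul_comm (α _) (α _)]
    · simp [dualNumberMode, hl]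
  · simp [dualNumberMode, hm]

/-- The additive map from `V^k(L)` to the dual numbers induced by an even functional `α` and an
odd functional `β`. -/
noncomputable def toDualNumber {α β : L →ₗ[ℂ] ℂ} (hα : ∀ x ∈ part (L := L) 1, α x = 0)
    (hβ : ∀ x ∈ part (L := L) 0, β x = 0) : UniversalAffine B k →+ DualNumber ℂ :=
  (NegEnveloping.lift (dualNumberMode α β) (dualNumberMode_bracket hα hβ) :
    NegEnveloping L →+ DualNumber ℂ).comp (toNegEnveloping B k)

theorem toDualNumber_mode_mul_mode {α β : L →ₗ[ℂ] ℂ} (hα : ∀ x ∈ part (L := L) 1, α x = 0)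
    (hβ : ∀ x ∈ part (L := L) 0, β x = 0) (x y : L) :
    toDualNumber B k hα hβ ((AffineEnveloping.mode B x (-1) * AffineEnveloping.mode B y (-1))
      • vacuum B k)
      = (algebraMap ℂ _ (α x) + β x • DualNumber.eps)
        * (algebraMap ℂ _ (α y) + β y • DualNumber.eps) := by
  rw [toDualNumber, AddMonoidHom.comp_apply, toNegEnveloping_mode_mul_mode]
  change NegEnveloping.lift _ _ _ = _
  rw [map_mul, lift_gen, lift_gen]
  rfl

end

end VacuumModule

/-! ### Commutation of modes and quadratic vectors -/

namespace AffineEnveloping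

open LieSuperalgebra

variable {L : Type} [AddCommGroup L] [Module ℂ L] [LieSuperalgebra L] (B : InvariantForm L)

/-- The mode `x t ^ m` as a linear function of `x`. -/
noncomputable def modeLinear (m : ℤ) : L →ₗ[ℂ] AffineEnveloping B where
  toFun x := mode B x m
  map_add' x y := (RingQuot.mkAlgHom_rel ℂ (AffineRel.add x y m)).trans (map_add _ _ _)
  map_smul' c x := (RingQuot.mkAlgHom_rel ℂ (AffineRel.smul c x m)).trans (map_smul _ _ _)

/-- Two modes supercommute up to the mode of the bracket when their central term vanishes. -/
theorem mode_mul_mode {a b : ZMod 2} {x y : L} (hx : x ∈ part a) (hy : y ∈ part b) (m l : ℤ)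
    (h : m + l = 0 → m * B.form x y = 0) :
    mode B x m * mode B y l
      = superSign a b • (mode B y l * mode B x m) + mode B (bracket x y) (m + l) := by
  have h1 := RingQuot.mkAlgHom_rel ℂ (AffineRel.bracket (B := B) hx hy m l)
  rw [ite_eq_right_iff.2 h, zero_smul, add_zero] at h1
  rw [map_sub, map_smul, map_mul, map_mul, sub_eq_iff_eq_add'] at h1
  exact h1

theorem mode_one_mul_translation (x : L) :
    mode B x 1 * translation B = translation B * mode B x 1 + mode B x 0 := by
  have h1 : translation B * mode B x 1 - mode B x 1 * translation B
      = -((1 : ℤ) : ℂ) • mode B x (1 - 1) := by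
    have h := RingQuot.mkAlgHom_rel ℂ (AffineRel.translation_mode (B := B) x 1)
    rw [map_sub, map_smul, map_mul, map_mul] at h
    exact h
  rw [Int.cast_one, neg_one_smul, sub_self, sub_eq_iff_eq_add] at h1
  rw [h1]
  abel

end AffineEnveloping

section Pairs

open LieSuperalgebra AffineEnveloping

variable {L : Type} [AddCommGroup L] [Module ℂ L] [LieSuperalgebra L] (B : InvariantForm L) (k : ℂ)

theorem mode_smul_vacuum (x : L) {m : ℤ} (hm : 0 ≤ m) : mode B x m • vacuum B k = 0 := by
  rw [vacuum, ← Submodule.Quotient.mk_smul, Submodule.Quotient.mk_eq_zero, smul_eq_mul, mul_one]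
  exact Submodule.subset_span (.inl ⟨x, m, hm, rfl⟩)

/-- The vector `x_(-1) y_(-1) |0⟩`, bilinear in `x` and `y`. -/
noncomputable def modePair : L →ₗ[ℂ] L →ₗ[ℂ] UniversalAffine B k :=
  ((LinearMap.mul ℂ (AffineEnveloping B)).compl₁₂ (modeLinear B (-1)) (modeLinear B (-1))).compr₂
    ((LinearMap.toSpanSingleton (AffineEnveloping B) _ (vacuum B k)).restrictScalars ℂ)

theorem modePair_apply (x y : L) :
    modePair B k x y = (mode B x (-1) * mode B y (-1)) • vacuum B k := rfl

variable {B} {a b c : ZMod 2} {x y z : L}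

theorem modePair_comm (hx : x ∈ part a) (hy : y ∈ part b) (h : bracket x y = 0) :
    modePair B k x y = superSign a b • modePair B k y x := by
  rw [modePair_apply, mode_mul_mode B hx hy _ _ (by norm_num), h, modePair_apply, add_smul,
    smul_assoc]
  rw [show mode B 0 (-1 + -1) = 0 from map_zero (modeLinear B _), zero_smul, add_zero]

theorem mode_zero_smul_modePair (hx : x ∈ part a) (hy : y ∈ part b) (hz : z ∈ part c) :
    mode B x 0 • modePair B k y z
      = modePair B k (bracket x y) z + superSign a b • modePair B k y (bracket x z) := by
  simp only [modePair_apply]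
  rw [← mul_smul, ← mul_assoc, mode_mul_mode B hx hy _ _ (by simp), add_mul, smul_mul_assoc,
    mul_assoc, mode_mul_mode B hx hz _ _ (by simp)]
  simp only [add_smul, smul_assoc, mul_add, mul_smul_comm, mul_smul, mode_smul_vacuum B k x le_rfl,
    smul_zero, zero_add]
  rw [add_comm]

theorem mode_one_smul_modePair (hx : x ∈ part a) (hy : y ∈ part b) (hz : z ∈ part c)
    (hxy : B.form x y = 0) (hxz : B.form x z = 0) (h : bracket (bracket x y) z = 0) :
    mode B x 1 • modePair B k y z = 0 := by
  rw [modePair_apply, ← mul_smul, ← mul_assoc, mode_mul_mode B hx hy _ _ (by simp [hxy]), add_mul,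
    smul_mul_assoc, mul_assoc, mode_mul_mode B hx hz _ _ (by simp [hxz]), add_neg_cancel,
    mode_mul_mode B (bracket_mem hx hy) hz _ _ (by simp), h,
    show mode B 0 (0 + -1) = 0 from map_zero (modeLinear B _)]
  simp only [add_smul, smul_assoc, mul_add, mul_smul_comm, mul_smul,
    mode_smul_vacuum B k _ le_rfl, mode_smul_vacuum B k _ zero_le_one, smul_zero, add_zero]

/-- Since `x_(1) T = T x_(1) + x_(0)`, the operator `x_(1) T` acts on `y_(-1) z_(-1) |0⟩` as the
superderivation `x_(0)` as soon as `x_(1)` kills this vector. -/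
theorem mode_one_mul_translation_smul_modePair (hx : x ∈ part a) (hy : y ∈ part b)
    (hz : z ∈ part c) (hxy : B.form x y = 0) (hxz : B.form x z = 0)
    (h : bracket (bracket x y) z = 0) :
    (mode B x 1 * translation B) • modePair B k y z
      = modePair B k (bracket x y) z + superSign a b • modePair B k y (bracket x z) := by
  rw [mode_one_mul_translation, add_smul, mul_smul, mode_one_smul_modePair k hx hy hz hxy hxz h,
    smul_zero, zero_add, mode_zero_smul_modePair k hx hy hz]

end Pairs

/-! ### Elementary matrices in `psl(n|n)` -/

section Elementary

open LieSuperalgebra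

variable (n : ℕ)

/-- The parity of the index `i` in the numbering `1, …, 2n`. -/
def natParity (i : ℕ) : ZMod 2 := if i ≤ n then 0 else 1

theorem elemMat_mem_matPart (i j : ℕ) :
    elemMat n i j ∈ matPart n (natParity n i + natParity n j) := by
  intro p q h
  by_cases hpq : p.val + 1 = i ∧ q.val + 1 = j
  · obtain ⟨rfl, rfl⟩ := hpq
    exact absurd rfl h
  · simp [elemMat, hpq]

theorem elemMat_mul_of_ne {j k : ℕ} (h : j ≠ k) (i l : ℕ) : elemMat n i j * elemMat n k l = 0 := by
  ext p q
  rw [Matrix.mul_apply]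
  refine Finset.sum_eq_zero fun r _ => ?_
  by_cases hr : r.val + 1 = j
  · have : r.val + 1 ≠ k := hr ▸ h
    simp [elemMat, this]
  · simp [elemMat, hr]

theorem elemMat_mul {j : ℕ} (h1 : 1 ≤ j) (h2 : j ≤ 2 * n) (i l : ℕ) :
    elemMat n i j * elemMat n j l = elemMat n i l := by
  ext p q
  rw [Matrix.mul_apply, Finset.sum_eq_single (⟨j - 1, by omega⟩ : Fin (2 * n))]
  · have : j - 1 + 1 = j := by omega
    simp only [elemMat, Matrix.of_apply, this, and_true, true_and]
    by_cases hp : p.val + 1 = i <;> simp [hp]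
  · intro r _ hr
    have : r.val + 1 ≠ j := fun h => hr (Fin.ext (by simp; omega))
    simp [elemMat, this]
  · simp

variable {n}

theorem pslE_mem (i j : ℕ) (h : i ≠ j) :
    pslE n i j h ∈ part (natParity n i + natParity n j) :=
  ⟨_, elemMat_mem_matPart n i j, rfl⟩

theorem pslE_bracket_eq_zero {i j k l : ℕ} (hij : i ≠ j) (hkl : k ≠ l) (hjk : j ≠ k)
    (hil : i ≠ l) : bracket (pslE n i j hij) (pslE n k l hkl) = 0 := by
  have : slBracket n ⟨_, elemMat_mem n hij⟩ ⟨_, elemMat_mem n hkl⟩ = 0 := Subtype.ext <| by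
    refine (matBracket_of_mem (elemMat_mem_matPart n i j) (elemMat_mem_matPart n k l)).trans ?_
    simp [elemMat_mul_of_ne n hjk, elemMat_mul_of_ne n hil.symm]
  exact (congrArg (pslMk n) this).trans (map_zero _)

theorem pslE_bracket {i j l : ℕ} (hij : i ≠ j) (hjl : j ≠ l) (hil : i ≠ l) (h1 : 1 ≤ j)
    (h2 : j ≤ 2 * n) : bracket (pslE n i j hij) (pslE n j l hjl) = pslE n i l hil := by
  have : slBracket n ⟨_, elemMat_mem n hij⟩ ⟨_, elemMat_mem n hjl⟩ = ⟨_, elemMat_mem n hil⟩ :=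
    Subtype.ext <| by
    refine (matBracket_of_mem (elemMat_mem_matPart n i j) (elemMat_mem_matPart n j l)).trans ?_
    simp [elemMat_mul n h1 h2, elemMat_mul_of_ne n hil.symm]
  exact congrArg (pslMk n) this

theorem pslForm_pslE_eq_zero {i j k l : ℕ} (hij : i ≠ j) (hkl : k ≠ l) (h : j ≠ k ∨ i ≠ l) :
    (pslForm n).form (pslE n i j hij) (pslE n k l hkl) = 0 := by
  change superTrace n (elemMat n i j * elemMat n k l) = 0
  by_cases hjk : j = k
  · subst hjk
    have hil : i ≠ l := h.resolve_left (by simp)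
    by_cases hj : 1 ≤ j ∧ j ≤ 2 * n
    · rw [elemMat_mul n hj.1 hj.2]
      exact elemMat_mem n hil
    · have : elemMat n i j = 0 := by
        ext p q
        have : ¬ q.val + 1 = j := by omega
        simp [elemMat, this]
      rw [this, zero_mul, map_zero]
  · rw [elemMat_mul_of_ne n hjk, map_zero]

/-- The matrix entry at an off-diagonal place `(p, q)`. It vanishes on the identity matrix, so it
is defined on `psl(n|n)`. -/
def pslCoeff {p q : Fin (2 * n)} (h : p ≠ q) : PSL n →ₗ[ℂ] ℂ :=
  (slCenter n).liftQ ((Matrix.entryLinearMap ℂ ℂ p q) ∘ₗ (slSuper n).subtype) <| by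
    rw [Submodule.span_singleton_le_iff_mem, LinearMap.mem_ker]
    exact Matrix.one_apply_ne h

theorem pslCoeff_pslE {p q : Fin (2 * n)} (h : p ≠ q) (i j : ℕ) (hij : i ≠ j) :
    pslCoeff h (pslE n i j hij) = if p.val + 1 = i ∧ q.val + 1 = j then 1 else 0 := rfl

theorem pslCoeff_eq_zero {p q : Fin (2 * n)} (h : p ≠ q) {a : ZMod 2}
    (ha : idxParity p + idxParity q ≠ a) {x : PSL n} (hx : x ∈ part a) : pslCoeff h x = 0 := by
  obtain ⟨X, hX, rfl⟩ := hx
  exact hX p q ha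

/-- A vector is not singular if some raising operator `E^{i,j}_(0)` does not kill it. -/
theorem not_isSingular {v : VPsl n} {i j : ℕ} (hij : i < j) (hi : 1 ≤ i) (hj : j ≤ 2 * n)
    (h : AffineEnveloping.mode (pslForm n) (pslE n i j hij.ne) 0 • v ≠ 0) : ¬ IsSingular v :=
  fun hv => h <| hv _ <| Submodule.subset_span <|
    .inl ⟨_, Submodule.subset_span ⟨i, j, hij, hi, hj, rfl⟩, rfl⟩

/-! ### The vectors `χ`, `χ₊` and `χ₋` -/

theorem chi_eq (hn : 1 < n) : chi hn = modePair (pslForm n) 1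
    (pslE n 1 (2 * n - 1) (by omega)) (pslE n 1 (2 * n) (by omega)) := rfl

theorem chiPlus_eq (hn : 1 < n) : chiPlus hn = modePair (pslForm n) 1
    (pslE n 1 n (by omega)) (pslE n 1 n (by omega)) := by
  rw [chiPlus, sq]
  rfl

theorem chiMinus_eq (hn : 3 < n) : chiMinus hn =
    modePair (pslForm n) 1 (pslE n (n + 1) (2 * n) (by omega))
      (pslE n (n + 2) (2 * n - 1) (by omega))
    - modePair (pslForm n) 1 (pslE n (n + 1) (2 * n - 1) (by omega))
      (pslE n (n + 2) (2 * n) (by omega)) := by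
  rw [chiMinus, sub_smul]
  rfl

theorem natParity_of_le {i : ℕ} (h : i ≤ n) : natParity n i = 0 := if_pos h

theorem natParity_of_lt {i : ℕ} (h : n < i) : natParity n i = 1 := if_neg h.not_ge

theorem idxParity_of_lt {p : Fin (2 * n)} (h : p.val < n) : idxParity p = 0 := if_pos h

theorem idxParity_of_le {p : Fin (2 * n)} (h : n ≤ p.val) : idxParity p = 1 := if_neg h.not_gt

theorem pslE_mem_odd_of_le_of_lt {i j : ℕ} (h : i ≠ j) (hi : i ≤ n) (hj : n < j) :
    pslE n i j h ∈ part 1 := by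
  simpa [natParity_of_le hi, natParity_of_lt hj] using pslE_mem (n := n) i j h

theorem pslE_mem_odd_of_lt_of_le {i j : ℕ} (h : i ≠ j) (hi : n < i) (hj : j ≤ n) :
    pslE n i j h ∈ part 1 := by
  simpa [natParity_of_lt hi, natParity_of_le hj] using pslE_mem (n := n) i j h

theorem pslE_mem_even_of_le {i j : ℕ} (h : i ≠ j) (hi : i ≤ n) (hj : j ≤ n) :
    pslE n i j h ∈ part 0 := by
  simpa [natParity_of_le hi, natParity_of_le hj] using pslE_mem (n := n) i j h

theorem pslE_mem_even_of_lt {i j : ℕ} (h : i ≠ j) (hi : n < i) (hj : n < j) :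
    pslE n i j h ∈ part 0 := by
  have h2 : (1 + 1 : ZMod 2) = 0 := by decide
  simpa [natParity_of_lt hi, natParity_of_lt hj, h2] using pslE_mem (n := n) i j h

theorem superSign_one_one : superSign 1 1 = -1 := by simp [superSign]

theorem superSign_zero_right (a : ZMod 2) : superSign a 0 = 1 := by simp [superSign]

/-- The operator `E^{2n,n}_(1) T` turns `χ` into `-E^{1,2n-1}_(-1) E^{1,n}_(-1) |0⟩`, and
`E^{2n-1,n}_(1) T` turns this into `-χ₊`. -/
theorem chiPlus_eq_descendant (hn : 1 < n) (h₁ : 2 * n - 1 ≠ n) (h₂ : 2 * n ≠ n) :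
    chiPlus hn = -((modeE n (2 * n - 1) n h₁ 1 * transT n *
        modeE n (2 * n) n h₂ 1 * transT n) • chi hn) := by
  have hc : pslE n 1 n (by omega) ∈ part 0 := pslE_mem_even_of_le _ hn.le le_rfl
  have ha : pslE n 1 (2 * n - 1) (by omega) ∈ part 1 :=
    pslE_mem_odd_of_le_of_lt _ hn.le (by omega)
  have hb : pslE n 1 (2 * n) (by omega) ∈ part 1 := pslE_mem_odd_of_le_of_lt _ hn.le (by omega)
  have hx : pslE n (2 * n) n (by omega) ∈ part 1 := pslE_mem_odd_of_lt_of_le _ (by omega) le_rfl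
  have hy : pslE n (2 * n - 1) n (by omega) ∈ part 1 :=
    pslE_mem_odd_of_lt_of_le _ (by omega) le_rfl
  have hxa : bracket (pslE n (2 * n) n (by omega)) (pslE n 1 (2 * n - 1) (by omega)) = 0 :=
    pslE_bracket_eq_zero _ _ (by omega) (by omega)
  have hxb : bracket (pslE n (2 * n) n (by omega)) (pslE n 1 (2 * n) (by omega))
      = pslE n 1 n (by omega) := by
    rw [bracket_skew hx hb, pslE_bracket _ _ (by omega) (by omega) (by omega), superSign_one_one]
    simp
  have hya : bracket (pslE n (2 * n - 1) n (by omega)) (pslE n 1 (2 * n - 1) (by omega))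
      = pslE n 1 n (by omega) := by
    rw [bracket_skew hy ha, pslE_bracket _ _ (by omega) (by omega) (by omega), superSign_one_one]
    simp
  have hyc : bracket (pslE n (2 * n - 1) n (by omega)) (pslE n 1 n (by omega)) = 0 :=
    pslE_bracket_eq_zero _ _ (by omega) (by omega)
  have hcc : bracket (pslE n 1 n (by omega)) (pslE n 1 n (by omega)) = 0 :=
    pslE_bracket_eq_zero _ _ (by omega) (by omega)
  rw [mul_assoc, mul_smul, chi_eq, chiPlus_eq]
  simp only [modeE, transT]
  rw [mode_one_mul_translation_smul_modePair 1 hx ha hb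
      (pslForm_pslE_eq_zero _ _ (by omega)) (pslForm_pslE_eq_zero _ _ (by omega))
      (by rw [hxa]; simp),
    hxa, hxb, superSign_one_one, map_zero, LinearMap.zero_apply, zero_add, neg_one_smul, smul_neg,
    mode_one_mul_translation_smul_modePair 1 hy ha hc
      (pslForm_pslE_eq_zero _ _ (by omega)) (pslForm_pslE_eq_zero _ _ (by omega))
      (by rw [hya, hcc]),
    hya, hyc]
  simp

/-- The operator `E^{n+1,1}_(1) T` turns `χ` into the difference of
`E^{n+1,2n-1}_(-1) E^{1,2n}_(-1) |0⟩` and `E^{1,2n-1}_(-1) E^{n+1,2n}_(-1) |0⟩`; then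
`E^{n+2,1}_(1) T` replaces the remaining index `1` by `n + 2`. -/
theorem chiMinus_eq_descendant (hn : 3 < n) (hn' : 1 < n) (h₁ : n + 2 ≠ 1) (h₂ : n + 1 ≠ 1) :
    chiMinus hn = -((modeE n (n + 2) 1 h₁ 1 * transT n *
        modeE n (n + 1) 1 h₂ 1 * transT n) • chi hn') := by
  have ha : pslE n 1 (2 * n - 1) (by omega) ∈ part 1 :=
    pslE_mem_odd_of_le_of_lt _ (by omega) (by omega)
  have hb : pslE n 1 (2 * n) (by omega) ∈ part 1 :=
    pslE_mem_odd_of_le_of_lt _ (by omega) (by omega)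
  have ha1 : pslE n (n + 1) (2 * n - 1) (by omega) ∈ part 0 :=
    pslE_mem_even_of_lt _ (by omega) (by omega)
  have hb1 : pslE n (n + 1) (2 * n) (by omega) ∈ part 0 :=
    pslE_mem_even_of_lt _ (by omega) (by omega)
  have ha2 : pslE n (n + 2) (2 * n - 1) (by omega) ∈ part 0 :=
    pslE_mem_even_of_lt _ (by omega) (by omega)
  have hx : pslE n (n + 1) 1 (by omega) ∈ part 1 :=
    pslE_mem_odd_of_lt_of_le _ (by omega) (by omega)
  have hy : pslE n (n + 2) 1 (by omega) ∈ part 1 :=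
    pslE_mem_odd_of_lt_of_le _ (by omega) (by omega)
  have hya1 : bracket (pslE n (n + 2) 1 (by omega)) (pslE n (n + 1) (2 * n - 1) (by omega)) = 0 :=
    pslE_bracket_eq_zero _ _ (by omega) (by omega)
  have hyb1 : bracket (pslE n (n + 2) 1 (by omega)) (pslE n (n + 1) (2 * n) (by omega)) = 0 :=
    pslE_bracket_eq_zero _ _ (by omega) (by omega)
  rw [mul_assoc, mul_smul, chi_eq, chiMinus_eq]
  simp only [modeE, transT]
  rw [mode_one_mul_translation_smul_modePair 1 hx ha hb
      (pslForm_pslE_eq_zero _ _ (by omega)) (pslForm_pslE_eq_zero _ _ (by omega))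
      (by rw [pslE_bracket _ _ (by omega) (by omega) (by omega),
            pslE_bracket_eq_zero _ _ (by omega) (by omega)]),
    pslE_bracket _ _ (by omega) (by omega) (by omega),
    pslE_bracket _ _ (by omega) (by omega) (by omega),
    superSign_one_one, neg_one_smul, smul_add, smul_neg,
    mode_one_mul_translation_smul_modePair 1 hy ha1 hb
      (pslForm_pslE_eq_zero _ _ (by omega)) (pslForm_pslE_eq_zero _ _ (by omega))
      (by rw [hya1]; simp),
    mode_one_mul_translation_smul_modePair 1 hy ha hb1
      (pslForm_pslE_eq_zero _ _ (by omega)) (pslForm_pslE_eq_zero _ _ (by omega))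
      (by rw [pslE_bracket _ _ (by omega) (by omega) (by omega),
            pslE_bracket_eq_zero _ _ (by omega) (by omega)]),
    hya1, hyb1,
    pslE_bracket _ _ (by omega) (by omega) (by omega),
    pslE_bracket _ _ (by omega) (by omega) (by omega),
    superSign_zero_right, modePair_comm 1 hb1 ha2 (pslE_bracket_eq_zero _ _ (by omega) (by omega)),
    superSign_zero_right]
  simp [sub_eq_add_neg]

/-- `E^{n,n+1}_(0) χ₊ = -2 E^{1,n}_(-1) E^{1,n+1}_(-1) |0⟩`, which is `-2 ε` in the dual numbers
when `α` and `β` are the entries at `(1, n)` and `(1, n + 1)`. -/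
theorem chiPlus_not_isSingular (hn : 1 < n) : ¬ IsSingular (chiPlus hn) := by
  refine not_isSingular (i := n) (j := n + 1) (by omega) (by omega) (by omega) fun h => ?_
  have hc : pslE n 1 n (by omega) ∈ part 0 := pslE_mem_even_of_le _ hn.le le_rfl
  have hx : pslE n n (n + 1) (by omega) ∈ part 1 := pslE_mem_odd_of_le_of_lt _ le_rfl (by omega)
  rw [chiPlus_eq, mode_zero_smul_modePair 1 hx hc hc, bracket_skew hx hc,
    pslE_bracket _ _ (by omega) (by omega) (by omega), superSign_zero_right, one_smul, one_smul,
    modePair_apply, modePair_apply] at h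
  have hp : (⟨0, by omega⟩ : Fin (2 * n)) ≠ ⟨n - 1, by omega⟩ := by simp; omega
  have hq : (⟨0, by omega⟩ : Fin (2 * n)) ≠ ⟨n, by omega⟩ := by simp; omega
  have := congrArg (toDualNumber (pslForm n) 1 (α := pslCoeff hp) (β := pslCoeff hq)
    (fun x hx => pslCoeff_eq_zero hp (by
      rw [idxParity_of_lt (by simp; omega), idxParity_of_lt (by simp; omega)]; decide) hx)
    (fun x hx => pslCoeff_eq_zero hq (by
      rw [idxParity_of_lt (by simp; omega), idxParity_of_le (by simp)]; decide) hx)) h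
  rw [map_add, toDualNumber_mode_mul_mode, toDualNumber_mode_mul_mode, map_zero] at this
  have hn1 : n - 1 + 1 = n := by omega
  have := congrArg TrivSqZeroExt.snd this
  simp [pslCoeff_pslE, hn1] at this

/-- `E^{n,n+1}_(0) χ₋` is the sum of `E^{n,2n}_(-1) E^{n+2,2n-1}_(-1) |0⟩` and
`-E^{n,2n-1}_(-1) E^{n+2,2n}_(-1) |0⟩`. In the dual numbers, with `α` and `β` the entries at
`(n + 2, 2n - 1)` and `(n, 2n)`, the first is `ε` and the second is zero. -/
theorem chiMinus_not_isSingular (hn : 3 < n) : ¬ IsSingular (chiMinus hn) := by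
  refine not_isSingular (i := n) (j := n + 1) (by omega) (by omega) (by omega) fun h => ?_
  have hx : pslE n n (n + 1) (by omega) ∈ part 1 := pslE_mem_odd_of_le_of_lt _ le_rfl (by omega)
  have even {i j : ℕ} (h : i ≠ j) (hi : n < i) (hj : n < j) := pslE_mem_even_of_lt (n := n) h hi hj
  rw [chiMinus_eq, smul_sub,
    mode_zero_smul_modePair 1 hx (even _ (by omega) (by omega)) (even _ (by omega) (by omega)),
    mode_zero_smul_modePair 1 hx (even _ (by omega) (by omega)) (even _ (by omega) (by omega)),
    pslE_bracket _ _ (by omega) (by omega) (by omega),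
    pslE_bracket _ _ (by omega) (by omega) (by omega),
    pslE_bracket_eq_zero _ _ (by omega) (by omega),
    pslE_bracket_eq_zero _ _ (by omega) (by omega), map_zero, smul_zero, map_zero,
    smul_zero, add_zero, add_zero, modePair_apply, modePair_apply] at h
  have hp : (⟨n + 1, by omega⟩ : Fin (2 * n)) ≠ ⟨2 * n - 2, by omega⟩ := by simp; omega
  have hq : (⟨n - 1, by omega⟩ : Fin (2 * n)) ≠ ⟨2 * n - 1, by omega⟩ := by simp; omega
  have h2 : (1 + 1 : ZMod 2) = 0 := by decide
  have := congrArg (toDualNumber (pslForm n) 1 (α := pslCoeff hp) (β := pslCoeff hq)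
    (fun x hx => pslCoeff_eq_zero hp (by
      rw [idxParity_of_le (by simp), idxParity_of_le (by simp; omega)]; decide) hx)
    (fun x hx => pslCoeff_eq_zero hq (by
      rw [idxParity_of_lt (by simp; omega), idxParity_of_le (by simp; omega)]; decide) hx)) h
  rw [map_sub, toDualNumber_mode_mul_mode, toDualNumber_mode_mul_mode, map_zero] at this
  have e1 : 2 * n - 2 + 1 = 2 * n - 1 := by omega
  have e2 : n - 1 + 1 = n := by omega
  have e3 : 2 * n - 1 + 1 = 2 * n := by omega
  have e4 : 2 * n ≠ 2 * n - 1 := by omega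
  have := congrArg TrivSqZeroExt.snd this
  simp [pslCoeff_pslE, e1, e2, e3, e4, e4.symm] at this

end Elementary

theorem mainTheorem8 :
    (∀ (n : ℕ) (hn : 1 < n),
      ¬ IsSingular (chiPlus hn) ∧
      chiPlus hn ∈ submoduleU hn ∧
      chiPlus hn = -((modeE n (2 * n - 1) n (by omega) 1 * transT n *
        modeE n (2 * n) n (by omega) 1 * transT n) • chi hn)) ∧
    (∀ (n : ℕ) (hn : 3 < n),
      ¬ IsSingular (chiMinus hn) ∧
      chiMinus hn ∈ submoduleU (show 1 < n by omega) ∧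
      chiMinus hn = -((modeE n (n + 2) 1 (by omega) 1 * transT n *
        modeE n (n + 1) 1 (by omega) 1 * transT n) • chi (show 1 < n by omega))) := by
  refine ⟨fun n hn => ?_, fun n hn => ?_⟩
  · have h := chiPlus_eq_descendant hn (by omega) (by omega)
    refine ⟨chiPlus_not_isSingular hn, ?_, h⟩
    rw [h]
    exact Submodule.neg_mem _ (Submodule.smul_mem _ _ (Submodule.mem_span_singleton_self _))
  · have h := chiMinus_eq_descendant hn (by omega) (by omega) (by omega)
    refine ⟨chiMinus_not_isSingular hn, ?_, h⟩
    rw [h]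
    exact Submodule.neg_mem _ (Submodule.smul_mem _ _ (Submodule.mem_span_singleton_self _))
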